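/- **Setting.** Let $d\ge 1$, $n\ge 1$. User $j\in[n]$ holds $x^{(j)}=(z^{(j)},l^{(j)})\in[-1,1]^d$ with features $z^{(j)}\in\mathbb R^{d-1}$ and label $l^{(j)}\in\mathbb R$, and has a prior $\pi^{(j)}$, a probability measure on $[-1,1]^d$. A mechanism is a Markov kernel $\mu$. It is *$\varepsilon$-LDP* if $\mu_x(R)\le e^{\varepsilon}\mu_{x'}(R)$ for all inputs $x,x'$ and events $R$. With a prior $\pi$ and $P=\pi\otimes\mu$, the pair is *$\delta$-BCDP* ($\delta\in\mathbb R_{\ge0}^d$) if $P\{M(x)\in R\mid x_i\in S\}\le e^{\delta_i}P\{M(x)\in R\mid x_i\in S'\}$ for all $i\in[d]$, all events $R$ and all measurable $S,S'$ with $\pi\{x_i\in S\},\pi\{x_i\in S'\}>0$. **Dependence assumption.** For a known $q\ge0$, all $j\in[n]$, all $i\in[d-1]$ and all measurable $S,S'$ with $\pi^{(j)}\{x_i\in S\},\pi^{(j)}\{x_i\in S'\}>0$: $\mathsf{TV}\bigl(\pi^{(j)}_{x_{-i}\mid x_i\in S},\pi^{(j)}_{x_{-i}\mid x_i\in S'}\bigr)\le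 q$. **Levels.** Let $\varepsilon\ge0$, $0\le\delta_1\le\dots\le\delta_d$, $\zeta\in(0,1]$, $\tilde\delta_i=\min\{\delta_i,\varepsilon\}$. Put $c_0=0$, $c_d=\min\{\log\frac{e^{\zeta\tilde\delta_1}+q-1}{q},\tilde\delta_d\}$ (with $c_d=\tilde\delta_d$ if $q=0$), and for $i<d$ put $c_i=c_d$ if $c_d\le\tilde\delta_i$ and $c_i=\tilde\delta_i-\log(1+qe^{c_d}-q)$ otherwise. **Mechanism $M_{\mathsf{mean}}(x,c)$.** Let $M_{\mathsf{LDP}}(v,\alpha,r)$ be a family of channels, taking $v$ in the ball of radius $r$ of $\mathbb R^m$ to a random vector of $\mathbb R^m$, for all $m\ge1$, each $\alpha$-LDP for $\alpha\ge0$, $r>0$. With $w_k=(c_k-c_{k-1})^2/(d-k+1)$, draw independently $Y^k\sim M_{\mathsf{LDP}}\bigl((x_k,\dots,x_d),c_k-c_{k-1},\sqrt{d-k+1}\bigr)$, $k\in[d]$, and return $\hat\nu_i=\bigl(\sum_{k\le i}Y^k_{i+1-k}w_k\bigr)/\sum_{k\le i}w_k$, $i\in[d]$ (read as $0$ if all these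 $w_k$ vanish). **Sphere channel.** In dimension $m$ let $B=\frac{\sqrt\pi}{2}\,m\,r\,\frac{e^\alpha+1}{e^\alpha-1}\,\frac{\Gamma((m+1)/2)}{\Gamma(m/2+1)}$. Draw $K\sim\mathrm{Bern}\bigl(\frac{e^\alpha}{e^\alpha+1}\bigr)$ and $S\sim\mathrm{Bern}\bigl(\frac12+\frac{\|v\|}{2r}\bigr)$ independently, put $\tilde v=(2S-1)rv/\|v\|$ (for $v=0$ replace $v/\|v\|$ by any fixed unit vector), and return a uniform point of $\{z:(2K-1)z^\top\tilde v>0,\ \|z\|=B\}$. For $\alpha=0$ return $0$. **Algorithm.** Each user sends two independent draws $\hat x^{(j,1)},\hat x^{(j,2)}\sim M_{\mathsf{mean}}(x^{(j)},c/2)$, independently across users. The server forms $$\hat f(\theta)=\frac1{2n}\sum_{j=1}^n\bigl(\theta^\top\hat z^{(j,1)}\hat z^{(j,2)\top}\theta-2\theta^\top\hat l^{(j,1)}\hat z^{(j,2)}\bigr),$$ and from the reports alone an optimizer (any, possibly randomized) computes $\hat\theta$. For the error bound, $\Theta\subset\mathbb R^{d-1}$ is nonempty, compact and convex, and almost surely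 $\hat\theta\in\Theta$ and $\hat f(\hat\theta)\le\min_\Theta\hat f+\frac1n$. Let $f(\theta)=\frac1n\sum_j\frac12(\theta^\top z^{(j)}-l^{(j)})^2$ and $f^*=\min_\Theta f$. **Theorem.** 1. *(Privacy.)* For every such family $M_{\mathsf{LDP}}$ and every optimizer, under the dependence assumption, for each user $j$ the report $x^{(j)}\mapsto(\hat x^{(j,1)},\hat x^{(j,2)})$ is $\varepsilon$-LDP and, with $\pi^{(j)}$, $\delta$-BCDP; the same holds for $x^{(j)}\mapsto\hat\theta$ for any fixed data of the other users. 2. The sphere channel is such a family. 3. *(Error rate.)* Let $M_{\mathsf{LDP}}$ be the sphere channel and $$r^2=\sum_{i=1}^d\Bigl(\sum_{k=1}^i\frac{(c_k-c_{k-1})^2}{d-k+1}\Bigr)^{-1}\in(0,\infty],\qquad \rho=\max_{\theta\in\Theta}(\|\theta\|^2+\|\theta\|).$$ For every $\Lambda$ there is a constant $C$ depending only on $\Lambda$ such that, whenever $c_d\le\Lambda$ (in particular whenever $\varepsilon\le\Lambda$), for all data $x^{(1)},\dots,x^{(n)}\in[-1,1]^d$, $f(\hat\theta)-f^*$ is integrable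 and $$\mathbb E\bigl[f(\hat\theta)-f^*\mid x^{(1)},\dots,x^{(n)}\bigr]\le C\rho\Bigl(\frac{\log d}{\sqrt n}(r^2+rd)\wedge d\Bigr)+\frac1n .$$ If moreover $\rho\ge1/\sqrt n$, the same bound holds without the term $\frac1n$. (Here $\frac{\log d}{\sqrt n}(r^2+rd)$ is read as $+\infty$ if $r^2=\infty$ and $d\ge2$, and as $0$ if $d=1$.) -/

import Mathlib

open MeasureTheory ProbabilityTheory Set Metric

open scoped ENNReal

/-! ## Privacy notions -/

/-- A mechanism (Markov kernel) `κ` is `ε`-LDP if `κ x R ≤ e^ε κ x' R` for all inputs and events. -/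
def IsLDP {X Y : Type*} [MeasurableSpace X] [MeasurableSpace Y] (κ : Kernel X Y) (ε : ℝ) : Prop :=
  ∀ (R : Set Y), MeasurableSet R → ∀ x x' : X, κ x R ≤ ENNReal.ofReal (Real.exp ε) * κ x' R

section Coordinates

variable {ι : Type*} {X : ι → Type*} [∀ i, MeasurableSpace (X i)]

/-- The event `{x_i ∈ S}`, i.e. the cylinder `S × X_{-i}`. -/
def coordEvent (i : ι) (S : Set (X i)) : Set (∀ i, X i) := {x | x i ∈ S}

/-- `P{M(x) ∈ R | x_i ∈ S}`, where `P = π ⊗ κ` is the joint law of the data and the output. -/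
noncomputable def condProbGivenCoord {Y : Type*} [MeasurableSpace Y] (π : Measure (∀ i, X i))
    (κ : Kernel (∀ i, X i) Y) (i : ι) (S : Set (X i)) (R : Set Y) : ℝ≥0∞ :=
  (π ⊗ₘ κ) (coordEvent i S ×ˢ R) / π (coordEvent i S)

/-- The pair `(π, κ)` is `δ`-BCDP. -/
def IsBCDP {Y : Type*} [MeasurableSpace Y] (π : Measure (∀ i, X i))
    (κ : Kernel (∀ i, X i) Y) (δ : ι → ℝ) : Prop :=
  ∀ (i : ι) (R : Set Y), MeasurableSet R → ∀ S S' : Set (X i),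
    MeasurableSet S → MeasurableSet S' → 0 < π (coordEvent i S) → 0 < π (coordEvent i S') →
    condProbGivenCoord π κ i S R ≤ ENNReal.ofReal (Real.exp (δ i)) * condProbGivenCoord π κ i S' R

/-- The conditional law of `x_{-i}` given `x_i ∈ S` under `π`. -/
noncomputable def condOthers (π : Measure (∀ i, X i)) (i : ι) (S : Set (X i)) :
    Measure (∀ j : {j : ι // j ≠ i}, X j) :=
  (cond π (coordEvent i S)).map (fun x j => x j)

end Coordinates

/-- Total variation distance `sup_A |P(A) - Q(A)|` (used for probability measures). -/
noncomputable def tvDist {Y : Type*} [MeasurableSpace Y] (P Q : Measure Y) : ℝ :=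
  sSup {t : ℝ | ∃ A : Set Y, MeasurableSet A ∧ t = |P.real A - Q.real A|}

/-! ## Independent products of mechanisms -/

/-- Given `x`, sample `Y i ∼ κ i x` independently over `i`. -/
noncomputable def prodKernel {ι : Type*} [Fintype ι] {X : Type*} [MeasurableSpace X]
    {Y : ι → Type*} [∀ i, MeasurableSpace (Y i)] (κ : ∀ i, Kernel X (Y i))
    [∀ i, IsMarkovKernel (κ i)] : Kernel X (∀ i, Y i) where
  toFun x := Measure.pi (fun i => κ i x)
  measurable' := by
    refine Measurable.measure_of_isPiSystem_of_isProbabilityMeasure generateFrom_pi.symm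
      isPiSystem_pi ?_
    rintro _ ⟨s, hs, rfl⟩
    simp only [Measure.pi_pi]
    refine Finset.measurable_prod _ (fun i _ => ?_)
    exact Kernel.measurable_coe (κ i) (hs i (mem_univ i))

instance {ι : Type*} [Fintype ι] {X : Type*} [MeasurableSpace X]
    {Y : ι → Type*} [∀ i, MeasurableSpace (Y i)] (κ : ∀ i, Kernel X (Y i))
    [∀ i, IsMarkovKernel (κ i)] : IsMarkovKernel (prodKernel κ) :=
  ⟨fun x => (inferInstance : IsProbabilityMeasure (Measure.pi (fun i => κ i x)))⟩

/-! ## Black-box local randomizers and the channel on the sphere -/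

/-- A family of randomized channels `M(v, α, r)`, one for every dimension `m + 1 ≥ 1`, level `α`
and radius `r`, taking inputs `v` in the Euclidean ball of radius `r`. -/
structure ChannelFamily where
  kernel : ∀ (m : ℕ) (_α r : ℝ),
    Kernel (closedBall (0 : EuclideanSpace ℝ (Fin (m + 1))) r) (EuclideanSpace ℝ (Fin (m + 1)))
  markov : ∀ (m : ℕ) (α r : ℝ), IsMarkovKernel (kernel m α r)

instance (M : ChannelFamily) (m : ℕ) (α r : ℝ) : IsMarkovKernel (M.kernel m α r) :=
  M.markov m α r

/-- Every channel of the family is locally private at its nominal level. -/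
def ChannelFamily.IsLDP (M : ChannelFamily) : Prop :=
  ∀ (m : ℕ) (α r : ℝ), 0 ≤ α → 0 < r → _root_.IsLDP (M.kernel m α r) α

/-- The surface measure of the unit sphere of `ℝ^m`, as a measure on `ℝ^m`. -/
noncomputable def sphereMeasure (m : ℕ) : Measure (EuclideanSpace ℝ (Fin m)) :=
  ((volume : Measure (EuclideanSpace ℝ (Fin m))).toSphere).map Subtype.val

instance (m : ℕ) : IsFiniteMeasure (sphereMeasure m) := by
  unfold sphereMeasure; infer_instance

/-- The uniform distribution on `{z : ⟪z, u⟫ > 0, ‖z‖ = B}`, for `B > 0` and `u ≠ 0`.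
For `B = 0` it is the point mass at `0`. -/
noncomputable def uniformHemisphere (m : ℕ) (B : ℝ) (u : EuclideanSpace ℝ (Fin m)) :
    Measure (EuclideanSpace ℝ (Fin m)) :=
  (cond (sphereMeasure m) {z | 0 < inner ℝ z u}).map (fun z => B • z)

/-- `v / ‖v‖`; for `v = 0` the first basis vector (the law of the channel below does not depend
on this choice, since for `v = 0` the sign of the direction is a fair coin). -/
noncomputable def unitDir {m : ℕ} (v : EuclideanSpace ℝ (Fin (m + 1))) :
    EuclideanSpace ℝ (Fin (m + 1)) :=
  if v = 0 then EuclideanSpace.single 0 1 else ‖v‖⁻¹ • v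

/-- The output radius in dimension `m`, normalized so that the output of the channel below is an
unbiased estimate of the input. For `α = 0` its value is `0`: at privacy level zero the channel
returns `0`, whatever the input. -/
noncomputable def sphereRadius (m : ℕ) (α r : ℝ) : ℝ :=
  Real.sqrt Real.pi / 2 * m * r * ((Real.exp α + 1) / (Real.exp α - 1)) *
    (Real.Gamma (((m : ℝ) + 1) / 2) / Real.Gamma ((m : ℝ) / 2 + 1))

/-- `P(X = b)` for `X ∼ Bern(p)`. -/
noncomputable def bernWeight (p : ℝ) (b : Bool) : ℝ≥0∞ :=
  ENNReal.ofReal (if b then p else 1 - p)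

/-- `2b - 1`. -/
def boolSign (b : Bool) : ℝ := if b then 1 else -1

/-- Law of the channel on input `v`: draw `K ∼ Bern(e^α/(e^α+1))` and
`S ∼ Bern(1/2 + ‖v‖/(2r))`, and then `Z` uniformly from the hemisphere of radius `B` on which
`(2K-1) ⟪z, ṽ⟫ > 0`, where `ṽ = (2S-1) r v/‖v‖` (the positive factor `r` plays no role here). -/
noncomputable def sphereChannelLaw (m : ℕ) (α r : ℝ) (v : EuclideanSpace ℝ (Fin (m + 1))) :
    Measure (EuclideanSpace ℝ (Fin (m + 1))) :=
  ∑ K : Bool, ∑ S : Bool,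
    (bernWeight (Real.exp α / (Real.exp α + 1)) K * bernWeight (1 / 2 + ‖v‖ / (2 * r)) S) •
      uniformHemisphere (m + 1) (sphereRadius (m + 1) α r)
        ((boolSign K * boolSign S) • unitDir v)

theorem measurable_unitDir {m : ℕ} :
    Measurable (unitDir : EuclideanSpace ℝ (Fin (m + 1)) → EuclideanSpace ℝ (Fin (m + 1))) := by
  unfold unitDir
  refine Measurable.ite (measurableSet_singleton 0) measurable_const ?_
  exact (measurable_norm.inv).smul measurable_id

theorem unitDir_ne_zero {m : ℕ} (v : EuclideanSpace ℝ (Fin (m + 1))) : unitDir v ≠ 0 := by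
  unfold unitDir
  split_ifs with h
  · intro h0
    have := congrArg (fun w : EuclideanSpace ℝ (Fin (m + 1)) => w 0) h0
    simp at this
  · simp [h]

theorem measurable_uniformHemisphere (m : ℕ) (B : ℝ) : Measurable (uniformHemisphere m B) := by
  refine Measure.measurable_of_measurable_coe _ (fun A hA => ?_)
  have hf : Measurable (fun z : EuclideanSpace ℝ (Fin m) => B • z) := measurable_const_smul B
  have hset : MeasurableSet
      {p : EuclideanSpace ℝ (Fin m) × EuclideanSpace ℝ (Fin m) | 0 < inner ℝ p.2 p.1} :=
    measurableSet_lt measurable_const (measurable_snd.inner measurable_fst)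
  have h1 := measurable_measure_prodMk_left (ν := sphereMeasure m) hset
  have h2 := measurable_measure_prodMk_left (ν := sphereMeasure m)
    (hset.inter (measurable_snd (hf hA)))
  have : (fun u => uniformHemisphere m B u A) = fun u =>
      (sphereMeasure m (Prod.mk u ⁻¹' {p | 0 < inner ℝ p.2 p.1}))⁻¹ *
        sphereMeasure m (Prod.mk u ⁻¹' ({p | 0 < inner ℝ p.2 p.1} ∩
          Prod.snd ⁻¹' ((fun z => B • z) ⁻¹' A))) := by
    funext u
    unfold uniformHemisphere
    rw [Measure.map_apply hf hA, cond_apply]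
    · rfl
    · exact measurable_prodMk_left hset
  rw [this]
  exact h1.inv.mul h2

theorem sphereMeasure_hemisphere_ne_zero {m : ℕ} {u : EuclideanSpace ℝ (Fin (m + 1))}
    (hu : u ≠ 0) : sphereMeasure (m + 1) {z | 0 < inner ℝ z u} ≠ 0 := by
  have ho : IsOpen {z : EuclideanSpace ℝ (Fin (m + 1)) | 0 < inner ℝ z u} :=
    isOpen_lt continuous_const (continuous_id.inner continuous_const)
  unfold sphereMeasure
  rw [Measure.map_apply measurable_subtype_coe ho.measurableSet]
  have ho' : IsOpen ((Subtype.val : sphere (0 : EuclideanSpace ℝ (Fin (m + 1))) 1 → _) ⁻¹'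
      {z | 0 < inner ℝ z u}) := ho.preimage continuous_subtype_val
  refine (ho'.measure_pos _ ⟨⟨‖u‖⁻¹ • u, ?_⟩, ?_⟩).ne'
  · simp [norm_smul, hu]
  · have : 0 < ‖u‖ := norm_pos_iff.mpr hu
    simp only [mem_preimage, mem_ofPred_eq, inner_smul_left, real_inner_self_eq_norm_sq]
    simp only [map_inv₀, conj_trivial]
    positivity

theorem isProbabilityMeasure_uniformHemisphere (m : ℕ) (B : ℝ)
    {u : EuclideanSpace ℝ (Fin (m + 1))} (hu : u ≠ 0) :
    IsProbabilityMeasure (uniformHemisphere (m + 1) B u) := by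
  have := cond_isProbabilityMeasure (sphereMeasure_hemisphere_ne_zero hu)
  exact Measure.isProbabilityMeasure_map (measurable_const_smul B).aemeasurable

theorem sum_bernWeight {p : ℝ} (h0 : 0 ≤ p) (h1 : p ≤ 1) : ∑ b : Bool, bernWeight p b = 1 := by
  simp only [Fintype.sum_bool, bernWeight, if_true, Bool.false_eq_true, if_false]
  rw [← ENNReal.ofReal_add h0 (by linarith)]
  simp

theorem isProbabilityMeasure_sphereChannelLaw (m : ℕ) (α r : ℝ)
    {v : EuclideanSpace ℝ (Fin (m + 1))} (hv : v ∈ closedBall 0 r) :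
    IsProbabilityMeasure (sphereChannelLaw m α r v) := by
  have hv' : ‖v‖ ≤ r := by simpa using hv
  have hr : 0 ≤ r := (norm_nonneg v).trans hv'
  have hS := sum_bernWeight (p := 1 / 2 + ‖v‖ / (2 * r)) (by positivity) (by
    have : ‖v‖ / (2 * r) ≤ 1 / 2 := by
      rw [mul_comm, ← div_div]
      have := div_le_one_of_le₀ hv' hr
      linarith
    linarith)
  have hK := sum_bernWeight (p := Real.exp α / (Real.exp α + 1)) (by positivity)
    (div_le_one_of_le₀ (by linarith) (by positivity))
  have hU : ∀ K S : Bool, uniformHemisphere (m + 1) (sphereRadius (m + 1) α r)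
      ((boolSign K * boolSign S) • unitDir v) univ = 1 := by
    intro K S
    have hne : (boolSign K * boolSign S) • unitDir v ≠ 0 := by
      refine smul_ne_zero ?_ (unitDir_ne_zero v)
      cases K <;> cases S <;> simp [boolSign]
    exact (isProbabilityMeasure_uniformHemisphere m _ hne).measure_univ
  constructor
  simp only [sphereChannelLaw, Measure.finsetSum_apply, Measure.smul_apply, hU, smul_eq_mul,
    mul_one]
  simp only [← Finset.mul_sum, hS, mul_one, hK]

theorem measurable_sphereChannelLaw (m : ℕ) (α r : ℝ) : Measurable (sphereChannelLaw m α r) := by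
  refine Measure.measurable_of_measurable_coe _ (fun A hA => ?_)
  simp only [sphereChannelLaw, Measure.finsetSum_apply, Measure.smul_apply, smul_eq_mul]
  refine Finset.measurable_sum _ (fun K _ => Finset.measurable_sum _ (fun S _ => ?_))
  refine Measurable.mul (Measurable.const_mul ?_ _) ?_
  · unfold bernWeight
    refine ENNReal.measurable_ofReal.comp ?_
    cases S <;> simp only [if_true, Bool.false_eq_true, if_false] <;> fun_prop
  · have hd : Measurable (fun v : EuclideanSpace ℝ (Fin (m + 1)) =>
        (boolSign K * boolSign S) • unitDir v) :=
      (measurable_const_smul (boolSign K * boolSign S)).comp measurable_unitDir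
    exact (Measure.measurable_coe hA).comp ((measurable_uniformHemisphere (m + 1) _).comp hd)

/-- The sphere channel as a family of Markov kernels. -/
noncomputable def sphereChannel : ChannelFamily where
  kernel m α r :=
    { toFun := fun v => sphereChannelLaw m α r v
      measurable' := (measurable_sphereChannelLaw m α r).comp measurable_subtype_coe }
  markov m α r := ⟨fun v => isProbabilityMeasure_sphereChannelLaw m α r v.2⟩

/-! ## The mean-estimation mechanism

Data live in `[-1,1]^d` with `d = p + 1`; coordinates are numbered `0, …, p`, so that coordinate
`k : Fin (p + 1)` is the `(k+1)`-st one. -/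

/-- The data domain `[-1,1]^d`, `d = p + 1`. -/
abbrev DataCube (p : ℕ) : Type := Fin (p + 1) → Icc (-1 : ℝ) 1

/-- The increment `c_k - c_{k-1}`, with `c_0 = 0` before the first coordinate. -/
def increment {p : ℕ} (c : Fin (p + 1) → ℝ) (k : Fin (p + 1)) : ℝ :=
  c k - (Fin.cons 0 c : Fin (p + 2) → ℝ) k.castSucc

/-- `w_k = (c_k - c_{k-1})² / (d - k + 1)` (the number of coordinates from `k` on is `p - k + 1`
in the numbering from `0`). -/
noncomputable def weight {p : ℕ} (c : Fin (p + 1) → ℝ) (k : Fin (p + 1)) : ℝ :=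
  increment c k ^ 2 / ((p - (k : ℕ) + 1 : ℕ) : ℝ)

/-- The vector of the coordinates of `x` from the `k`-th on. -/
noncomputable def tailVec {p : ℕ} (k : Fin (p + 1)) (x : DataCube p) :
    EuclideanSpace ℝ (Fin (p - (k : ℕ) + 1)) :=
  WithLp.toLp 2 (fun j => (x ⟨(k : ℕ) + (j : ℕ), by omega⟩ : ℝ))

theorem tailVec_mem {p : ℕ} (k : Fin (p + 1)) (x : DataCube p) :
    tailVec k x ∈ closedBall (0 : EuclideanSpace ℝ (Fin (p - (k : ℕ) + 1)))
      (Real.sqrt ((p - (k : ℕ) + 1 : ℕ) : ℝ)) := by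
  rw [mem_closedBall_zero_iff, EuclideanSpace.norm_eq]
  refine Real.sqrt_le_sqrt ?_
  calc ∑ j, ‖tailVec k x j‖ ^ 2 ≤ ∑ _j : Fin (p - (k : ℕ) + 1), (1 : ℝ) := by
        refine Finset.sum_le_sum (fun j _ => ?_)
        have h := (x ⟨(k : ℕ) + (j : ℕ), by omega⟩).2
        have h' : |tailVec k x j| ≤ 1 := abs_le.mpr ⟨h.1, h.2⟩
        rw [Real.norm_eq_abs]
        exact pow_le_one₀ (abs_nonneg _) h'
    _ = _ := by simp

theorem measurable_tailVec {p : ℕ} (k : Fin (p + 1)) :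
    Measurable (tailVec k : DataCube p → _) := by
  unfold tailVec
  refine (WithLp.measurable_toLp 2 _).comp ?_
  refine measurable_pi_lambda _ (fun j => ?_)
  exact measurable_subtype_coe.comp (measurable_pi_apply _)

/-- `Y^k ← M_LDP(x_{k:d}, c_k - c_{k-1}, √(d-k+1))`. -/
noncomputable def tailChannel (M : ChannelFamily) {p : ℕ} (c : Fin (p + 1) → ℝ)
    (k : Fin (p + 1)) : Kernel (DataCube p) (EuclideanSpace ℝ (Fin (p - (k : ℕ) + 1))) :=
  (M.kernel (p - (k : ℕ)) (increment c k) (Real.sqrt ((p - (k : ℕ) + 1 : ℕ) : ℝ))).comap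
    (fun x => ⟨tailVec k x, tailVec_mem k x⟩) ((measurable_tailVec k).subtype_mk)

instance (M : ChannelFamily) {p : ℕ} (c : Fin (p + 1) → ℝ) (k : Fin (p + 1)) :
    IsMarkovKernel (tailChannel M c k) := by
  unfold tailChannel; infer_instance

/-- `ν̂_i = (∑_{k ≤ i} Y^k_{i+1-k} w_k) / (∑_{k ≤ i} w_k)`: the entry of `Y^k` that corresponds to
coordinate `i` has index `i - k` in the numbering from `0`. -/
noncomputable def aggregate {p : ℕ} (c : Fin (p + 1) → ℝ)
    (Y : ∀ k : Fin (p + 1), EuclideanSpace ℝ (Fin (p - (k : ℕ) + 1))) :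
    EuclideanSpace ℝ (Fin (p + 1)) :=
  WithLp.toLp 2 (fun i =>
    (∑ k ∈ Finset.Iic i, Y k ⟨(i : ℕ) - (k : ℕ), by omega⟩ * weight c k) /
      ∑ k ∈ Finset.Iic i, weight c k)

theorem measurable_aggregate {p : ℕ} (c : Fin (p + 1) → ℝ) : Measurable (aggregate c) := by
  unfold aggregate
  refine (WithLp.measurable_toLp 2 _).comp ?_
  fun_prop

/-- The mechanism `M_mean(x, c)` built on the black box `M`: the `Y^k` are drawn independently
given `x` and then aggregated. -/
noncomputable def meanMechanism (M : ChannelFamily) {p : ℕ} (c : Fin (p + 1) → ℝ) :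
    Kernel (DataCube p) (EuclideanSpace ℝ (Fin (p + 1))) :=
  (prodKernel (fun k => tailChannel M c k)).map (aggregate c)

instance (M : ChannelFamily) {p : ℕ} (c : Fin (p + 1) → ℝ) :
    IsMarkovKernel (meanMechanism M c) :=
  Kernel.IsMarkovKernel.map _ (measurable_aggregate c)

/-! ## Privacy parameters -/

/-- `c_d = min {log((e^{ζ δ̃_1} + q - 1)/q), δ̃_d}` with `δ̃_i = min {δ_i, ε}`; for `q = 0` the first
term is read as `+∞`. -/
noncomputable def lastLevel {p : ℕ} (δ : Fin (p + 1) → ℝ) (ε ζ q : ℝ) : ℝ :=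
  if q = 0 then min (δ (Fin.last p)) ε
  else min (Real.log ((Real.exp (ζ * min (δ 0) ε) + q - 1) / q)) (min (δ (Fin.last p)) ε)

/-- The vector `c`. -/
noncomputable def levels {p : ℕ} (δ : Fin (p + 1) → ℝ) (ε ζ q : ℝ) (i : Fin (p + 1)) : ℝ :=
  if i = Fin.last p then lastLevel δ ε ζ q
  else if lastLevel δ ε ζ q ≤ min (δ i) ε then lastLevel δ ε ζ q
  else min (δ i) ε - Real.log (1 + q * Real.exp (lastLevel δ ε ζ q) - q)

/-! ## Least squares -/

/-- What one user sends: two independent runs of `M_mean(x, c/2)`. -/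
noncomputable def userReport (M : ChannelFamily) {p : ℕ} (c : Fin (p + 1) → ℝ) :
    Kernel (DataCube p) (EuclideanSpace ℝ (Fin (p + 1)) × EuclideanSpace ℝ (Fin (p + 1))) :=
  (meanMechanism M (fun i => c i / 2)).prod (meanMechanism M (fun i => c i / 2))

instance (M : ChannelFamily) {p : ℕ} (c : Fin (p + 1) → ℝ) :
    IsMarkovKernel (userReport M c) := by
  unfold userReport; infer_instance

/-- The collection of all reports received by the server. -/
abbrev Reports (n p : ℕ) : Type :=
  Fin n → EuclideanSpace ℝ (Fin (p + 1)) × EuclideanSpace ℝ (Fin (p + 1))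

/-- The reports of all the users; users randomize independently. -/
noncomputable def allReports (M : ChannelFamily) (n : ℕ) {p : ℕ} (c : Fin (p + 1) → ℝ) :
    Kernel (Fin n → DataCube p) (Reports n p) :=
  prodKernel (fun j => (userReport M c).comap (fun x : Fin n → DataCube p => x j)
    (measurable_pi_apply j))

/-- The full algorithm: users' data ↦ returned parameter, where the (possibly randomized)
optimizer `opt` sees only the reports. -/
noncomputable def lseMechanism (M : ChannelFamily) {n p : ℕ} (c : Fin (p + 1) → ℝ)
    (opt : Kernel (Reports n p) (EuclideanSpace ℝ (Fin p))) :
    Kernel (Fin n → DataCube p) (EuclideanSpace ℝ (Fin p)) :=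
  opt ∘ₖ allReports M n c

/-- The output as a mechanism acting on the data of user `j`, the data of the other users being
fixed to be those in `x`. -/
noncomputable def lseMechanismAt (M : ChannelFamily) {n p : ℕ} (c : Fin (p + 1) → ℝ)
    (opt : Kernel (Reports n p) (EuclideanSpace ℝ (Fin p))) (x : Fin n → DataCube p) (j : Fin n) :
    Kernel (DataCube p) (EuclideanSpace ℝ (Fin p)) :=
  (lseMechanism M c opt).comap (Function.update x j) (measurable_update x)

/-- `θᵀ z`, where `z` consists of all coordinates of the vector `y` but the last (the label). -/
def featureDot {p : ℕ} (θ : EuclideanSpace ℝ (Fin p)) (y : Fin (p + 1) → ℝ) : ℝ :=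
  ∑ i : Fin p, θ i * y i.castSucc

/-- The empirical risk `f(θ) = (1/n) ∑_j (θᵀ z^{(j)} - l^{(j)})² / 2`. -/
noncomputable def empRisk {n p : ℕ} (x : Fin n → DataCube p) (θ : EuclideanSpace ℝ (Fin p)) : ℝ :=
  (1 / (n : ℝ)) * ∑ j, (1 / 2) *
    (featureDot θ (fun i => (x j i : ℝ)) - (x j (Fin.last p) : ℝ)) ^ 2

/-- The surrogate
`f̂(θ) = (1/(2n)) ∑_j (θᵀ ẑ^{(j,1)} ẑ^{(j,2)ᵀ} θ - 2 θᵀ l̂^{(j,1)} ẑ^{(j,2)})`. -/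
noncomputable def surrogate {n p : ℕ} (T : Reports n p) (θ : EuclideanSpace ℝ (Fin p)) : ℝ :=
  (1 / (2 * (n : ℝ))) * ∑ j,
    (featureDot θ (T j).1 * featureDot θ (T j).2
      - 2 * ((T j).1 (Fin.last p) * featureDot θ (T j).2))

/-- `opt` returns a point of `Θ` that minimizes the surrogate over `Θ` up to an error `1/n`. -/
def IsApproxMinimizer {n p : ℕ} (Θ : Set (EuclideanSpace ℝ (Fin p)))
    (opt : Kernel (Reports n p) (EuclideanSpace ℝ (Fin p))) : Prop :=
  ∀ T : Reports n p, ∀ᵐ θ ∂(opt T), θ ∈ Θ ∧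
    ∀ θ' ∈ Θ, surrogate T θ ≤ surrogate T θ' + 1 / (n : ℝ)

/-- `r² = ∑_i 1 / ∑_{k ≤ i} (c_k - c_{k-1})²/(d-k+1)`, equal to `∞` if a denominator vanishes. -/
noncomputable def rSq {p : ℕ} (c : Fin (p + 1) → ℝ) : ℝ≥0∞ :=
  ∑ i, (∑ k ∈ Finset.Iic i, ENNReal.ofReal (weight c k))⁻¹

/-- `((log d / √n) (r² + r d)) ∧ d` with `d = p + 1`; a finite number, being at most `d`. -/
noncomputable def lseRate (n : ℕ) {p : ℕ} (c : Fin (p + 1) → ℝ) : ℝ :=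
  (min (ENNReal.ofReal (Real.log ((p : ℝ) + 1) / Real.sqrt n) *
      (rSq c + rSq c ^ (1 / 2 : ℝ) * ((p + 1 : ℕ) : ℝ≥0∞))) ((p + 1 : ℕ) : ℝ≥0∞)).toReal

/-- `max_{θ ∈ Θ} (‖θ‖² + ‖θ‖)`. -/
noncomputable def maxNormTerm {p : ℕ} (Θ : Set (EuclideanSpace ℝ (Fin p))) : ℝ :=
  sSup ((fun θ => ‖θ‖ ^ 2 + ‖θ‖) '' Θ)

/-! ## Domination of measures -/

/-! Privacy. The `k`-th channel sees only the coordinates from `k` on and spends `c_k - c_{k-1}`, so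
changing the coordinates up to `i` costs the telescoping sum `c_i` (`meanMechanism_le`); two runs at
`c/2` cost `c_i` again. Hence a report is `c_d`-LDP with `c_d ≤ ε`, which already settles every
coordinate with `c_d ≤ δ_i`. For the other coordinates, conditioning on `x_i` also shifts the law of
`x_{-i}`, by at most `q` in total variation. The output probability, averaged over `x_i`, is a
function of `x_{-i}` that varies by a factor of at most `e^{c_d}`, so the shift costs a factor `1 +
q(e^{c_d} - 1)` (`bind_cond_coordEvent_le`). The levels are defined so that `e^{c_i}` times this
factor is `e^{δ̃_i}`. The returned parameter is a post-processing of the report.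

Sphere channel. Each output law is a combination of the uniform laws on two opposite hemispheres,
with both weights between `1/(e^α+1)` and `e^α/(e^α+1)`. The sum of the two hemisphere laws does not
depend on the input, so any two output laws differ by a factor of at most `e^α`.

Error rate. The output radius makes the channel unbiased, and in dimension `m` at radius `√m` each
coordinate has second moment of order `m/α²`, which is `1/w_k` for the `k`-th channel. The weights
`w_k` are thus inverse variances, coordinate `i` of the estimate has variance of order `1/∑_{k≤i}
w_k`, and these variances sum to order `r²`. Up to a term free of `θ`, the surrogate minus the risk
is a quadratic plus a linear form in `θ` whose coefficients are entries of the error matrix of the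
second moments. Cauchy-Schwarz bounds it by `‖θ‖² + ‖θ‖` times the Frobenius norm of that matrix
(`abs_surrogate_sub_empRisk_le`). The two independent runs make the entries centred, and
independence over users gives a mean Frobenius norm of order `(r² + rd)/√n`
(`integral_reportErrorNorm_le`). No logarithm arises; for `d ≥ 2` the factor `log d ≥ log 2` is
absorbed in the constant. The cap `d` is the same deterministic comparison applied to reports that
are all zero. -/

theorem MeasureTheory.Measure.pi_mono_of_le {ι : Type*} [Fintype ι] {X : ι → Type*}
    [∀ i, MeasurableSpace (X i)] {μ ν : ∀ i, Measure (X i)} [∀ i, SigmaFinite (μ i)]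
    (h : ∀ i, μ i ≤ ν i) : Measure.pi μ ≤ Measure.pi ν := by
  -- The product measure comes from the largest outer measure that is at most the product of the
  -- side measures on boxes, so a comparison on boxes is enough, and nothing is asked of `ν`.
  have key : (Measure.pi μ).toOuterMeasure ≤
      OuterMeasure.pi fun i => (ν i).toOuterMeasure := by
    rw [OuterMeasure.le_pi]
    intro s _
    calc Measure.pi μ (Set.pi univ s) = ∏ i, μ i (s i) := Measure.pi_pi μ s
      _ ≤ ∏ i, ν i (s i) := Finset.prod_le_prod' fun i _ => h i (s i)
  refine Measure.le_iff.mpr fun A hA => ?_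
  rw [Measure.pi_def ν, toMeasure_apply _ _ hA]
  exact key A

theorem MeasureTheory.Measure.pi_smul_le {ι : Type*} [Fintype ι] {X : ι → Type*}
    [∀ i, MeasurableSpace (X i)] {ν : ∀ i, Measure (X i)} [∀ i, IsFiniteMeasure (ν i)]
    {a : ι → ℝ≥0∞} (ha : ∀ i, a i ≠ ∞) :
    Measure.pi (fun i => a i • ν i) = (∏ i, a i) • Measure.pi ν := by
  have : ∀ i, IsFiniteMeasure (a i • ν i) := fun i => Measure.smul_finite _ (ha i)
  refine (Measure.pi_eq fun s _ => ?_)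
  simp [Finset.prod_mul_distrib]

theorem MeasureTheory.Measure.pi_le_smul_pi {ι : Type*} [Fintype ι] {X : ι → Type*}
    [∀ i, MeasurableSpace (X i)] {μ ν : ∀ i, Measure (X i)} [∀ i, IsFiniteMeasure (μ i)]
    [∀ i, IsFiniteMeasure (ν i)] {a : ι → ℝ≥0∞} (ha : ∀ i, a i ≠ ∞)
    (h : ∀ i, μ i ≤ a i • ν i) : Measure.pi μ ≤ (∏ i, a i) • Measure.pi ν :=
  (Measure.pi_mono_of_le h).trans (Measure.pi_smul_le ha).le

theorem MeasureTheory.Measure.bind_le_smul_bind {X Y : Type*} [MeasurableSpace X]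
    [MeasurableSpace Y] {μ ν : Measure X} {a : ℝ≥0∞} (h : μ ≤ a • ν) (κ : Kernel X Y) :
    μ.bind κ ≤ a • ν.bind κ := by
  refine Measure.le_iff.mpr fun A hA => ?_
  rw [Measure.smul_apply, Measure.bind_apply hA κ.measurable.aemeasurable,
    Measure.bind_apply hA κ.measurable.aemeasurable, smul_eq_mul, ← smul_eq_mul,
    ← lintegral_smul_measure]
  exact lintegral_mono' h le_rfl

theorem MeasureTheory.Measure.map_le_smul_map {X Y : Type*} [MeasurableSpace X]
    [MeasurableSpace Y] {μ ν : Measure X} {a : ℝ≥0∞} (h : μ ≤ a • ν) {f : X → Y}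
    (hf : Measurable f) : μ.map f ≤ a • ν.map f := by
  rw [← Measure.map_smul]
  exact Measure.map_mono h hf

theorem isLDP_iff {X Y : Type*} [MeasurableSpace X] [MeasurableSpace Y] {κ : Kernel X Y} {ε : ℝ} :
    IsLDP κ ε ↔ ∀ x x', κ x ≤ ENNReal.ofReal (Real.exp ε) • κ x' := by
  simp only [Measure.le_iff, Measure.smul_apply, smul_eq_mul]
  exact ⟨fun h x x' R hR => h R hR x x', fun h R hR x x' => h x x' R hR⟩

theorem IsLDP.mono {X Y : Type*} [MeasurableSpace X] [MeasurableSpace Y] {κ : Kernel X Y}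
    {ε ε' : ℝ} (h : IsLDP κ ε) (hε : ε ≤ ε') : IsLDP κ ε' := by
  intro R hR x x'
  refine (h R hR x x').trans ?_
  gcongr

/-- Post-processing preserves local differential privacy. -/
theorem IsLDP.comp {X Y Z : Type*} [MeasurableSpace X] [MeasurableSpace Y] [MeasurableSpace Z]
    {κ : Kernel X Y} {ε : ℝ} (h : IsLDP κ ε) (η : Kernel Y Z) : IsLDP (η ∘ₖ κ) ε := by
  rw [isLDP_iff] at h ⊢
  intro x x'
  rw [Kernel.comp_apply, Kernel.comp_apply]
  exact Measure.bind_le_smul_bind (h x x') η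

/-! ## Total variation -/

theorem measure_le_add_of_tvDist_le {Y : Type*} [MeasurableSpace Y] {P Q : Measure Y}
    [IsProbabilityMeasure P] [IsProbabilityMeasure Q] {q : ℝ} (h : tvDist P Q ≤ q) {A : Set Y}
    (hA : MeasurableSet A) : P A ≤ Q A + ENNReal.ofReal q := by
  have hb : BddAbove {t : ℝ | ∃ A : Set Y, MeasurableSet A ∧ t = |P.real A - Q.real A|} := by
    refine ⟨1, ?_⟩
    rintro t ⟨B, -, rfl⟩
    rw [abs_le]
    constructor <;> linarith [measureReal_le_one (μ := P) (s := B),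
      measureReal_le_one (μ := Q) (s := B), measureReal_nonneg (μ := P) (s := B),
      measureReal_nonneg (μ := Q) (s := B)]
  have h1 : |P.real A - Q.real A| ≤ q := (le_csSup hb ⟨A, hA, rfl⟩).trans h
  have h2 : P.real A ≤ Q.real A + q := by linarith [le_abs_self (P.real A - Q.real A)]
  have hq : 0 ≤ q := (abs_nonneg _).trans h1
  rw [← ofReal_measureReal (μ := P), ← ofReal_measureReal (μ := Q),
    ← ENNReal.ofReal_add measureReal_nonneg hq]
  exact ENNReal.ofReal_le_ofReal h2

/-- Layer cake: after subtraction of the lower bound `m`, each superlevel set changes its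
probability by at most `q`, and only levels in `(0, D)` contribute. -/
theorem lintegral_le_add_of_tvDist_le {Y : Type*} [MeasurableSpace Y] {P Q : Measure Y}
    [IsProbabilityMeasure P] [IsProbabilityMeasure Q] {q : ℝ} (h : tvDist P Q ≤ q)
    {g : Y → ℝ≥0∞} (hg : Measurable g) {m D : ℝ≥0∞} (hD : D ≠ ∞)
    (hmg : ∀ y, m ≤ g y) (hgD : ∀ y, g y ≤ m + D) :
    ∫⁻ y, g y ∂P ≤ ∫⁻ y, g y ∂Q + ENNReal.ofReal q * D := by
  have hfin : ∀ y, g y - m ≠ ∞ := fun y =>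
    ne_top_of_le_ne_top hD (tsub_le_iff_left.mpr (hgD y))
  set f : Y → ℝ := fun y => (g y - m).toReal with hf
  have hfm : Measurable f := (hg.sub measurable_const).ennreal_toReal
  have hf0 : ∀ y, 0 ≤ f y := fun y => ENNReal.toReal_nonneg
  have hgf : ∀ y, g y = m + ENNReal.ofReal (f y) := fun y => by
    rw [hf, ENNReal.ofReal_toReal (hfin y), add_tsub_cancel_of_le (hmg y)]
  have hfD : ∀ y, f y ≤ D.toReal := fun y =>
    ENNReal.toReal_mono hD (tsub_le_iff_left.mpr (hgD y))
  have hsplit : ∀ ν : Measure Y, IsProbabilityMeasure ν →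
      ∫⁻ y, g y ∂ν = m + ∫⁻ t in Ioi (0 : ℝ), ν {y | t < f y} := fun ν _ => by
    simp_rw [hgf]
    rw [lintegral_add_left measurable_const, lintegral_const, measure_univ, mul_one,
      lintegral_eq_lintegral_meas_lt ν (.of_forall hf0) hfm.aemeasurable]
  rw [hsplit P inferInstance, hsplit Q inferInstance, add_assoc]
  gcongr
  calc ∫⁻ t in Ioi (0 : ℝ), P {y | t < f y}
      ≤ ∫⁻ t in Ioi (0 : ℝ), (Q {y | t < f y} +
          (Iio D.toReal).indicator (fun _ => ENNReal.ofReal q) t) := by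
        refine lintegral_mono fun t => ?_
        by_cases ht : t < D.toReal
        · rw [indicator_of_mem (by exact ht)]
          exact measure_le_add_of_tvDist_le h (hfm measurableSet_Ioi)
        · have : {y | t < f y} = ∅ := by
            ext y
            simpa using (hfD y).trans (not_lt.mp ht)
          simp [this]
    _ = (∫⁻ t in Ioi (0 : ℝ), Q {y | t < f y}) + ENNReal.ofReal q * D := by
        rw [lintegral_add_right _ (measurable_const.indicator measurableSet_Iio),
          lintegral_indicator measurableSet_Iio, setLIntegral_const,
          Measure.restrict_apply measurableSet_Iio, inter_comm, Ioi_inter_Iio, Real.volume_Ioo,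
          sub_zero, ENNReal.ofReal_toReal hD]

/-! ## Privacy for a single coordinate -/

section Coordinates

variable {ι : Type*} {X : ι → Type*} [∀ i, MeasurableSpace (X i)] {Y : Type*} [MeasurableSpace Y]

theorem measurableSet_coordEvent (i : ι) {S : Set (X i)} (hS : MeasurableSet S) :
    MeasurableSet (coordEvent i S) := measurable_pi_apply i hS

theorem condProbGivenCoord_eq_bind (π : Measure (∀ i, X i)) [IsFiniteMeasure π]
    (κ : Kernel (∀ i, X i) Y) [IsSFiniteKernel κ] (i : ι) {S : Set (X i)} (hS : MeasurableSet S)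
    {R : Set Y} (hR : MeasurableSet R) :
    condProbGivenCoord π κ i S R = ((cond π (coordEvent i S)).bind κ) R := by
  rw [condProbGivenCoord, Measure.compProd_apply_prod (measurableSet_coordEvent i hS) hR,
    Measure.bind_apply hR κ.measurable.aemeasurable, ProbabilityTheory.cond,
    lintegral_smul_measure, ENNReal.div_eq_inv_mul, smul_eq_mul]

theorem isBCDP_iff {π : Measure (∀ i, X i)} [IsFiniteMeasure π]
    {κ : Kernel (∀ i, X i) Y} [IsSFiniteKernel κ] {δ : ι → ℝ} :
    IsBCDP π κ δ ↔ ∀ (i : ι) (S S' : Set (X i)), MeasurableSet S → MeasurableSet S' →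
      0 < π (coordEvent i S) → 0 < π (coordEvent i S') →
      (cond π (coordEvent i S)).bind κ ≤
        ENNReal.ofReal (Real.exp (δ i)) • (cond π (coordEvent i S')).bind κ := by
  simp only [Measure.le_iff, Measure.smul_apply, smul_eq_mul]
  constructor
  · intro h i S S' hS hS' h0 h0' R hR
    rw [← condProbGivenCoord_eq_bind π κ i hS hR, ← condProbGivenCoord_eq_bind π κ i hS' hR]
    exact h i R hR S S' hS hS' h0 h0'
  · intro h i R hR S S' hS hS' h0 h0'
    rw [condProbGivenCoord_eq_bind π κ i hS hR, condProbGivenCoord_eq_bind π κ i hS' hR]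
    exact h i S S' hS hS' h0 h0' R hR

/-- Post-processing preserves Bayesian coordinate differential privacy. -/
theorem IsBCDP.comp {Z : Type*} [MeasurableSpace Z] {π : Measure (∀ i, X i)} [IsFiniteMeasure π]
    {κ : Kernel (∀ i, X i) Y} [IsSFiniteKernel κ] {δ : ι → ℝ} (h : IsBCDP π κ δ)
    (η : Kernel Y Z) [IsSFiniteKernel η] : IsBCDP π (η ∘ₖ κ) δ := by
  rw [isBCDP_iff] at h ⊢
  intro i S S' hS hS' h0 h0'
  have hb : ∀ ρ : Measure (∀ i, X i), ρ.bind (η ∘ₖ κ) = (ρ.bind κ).bind η := fun ρ =>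
    Measure.comp_assoc.symm
  rw [hb, hb]
  exact Measure.bind_le_smul_bind (h i S S' hS hS' h0 h0') η

/-- If changing only coordinate `i` changes the output law by a factor at most `e^a`, changing all
of `x` by a factor at most `e^b`, and the remaining coordinates depend on coordinate `i` by at most
`q` in total variation, then the output given an event on coordinate `i` is determined up to a
factor `e^a (1 + q (e^b - 1))`. -/
theorem bind_cond_coordEvent_le [Countable ι] [∀ i, StandardBorelSpace (X i)]
    [∀ i, Nonempty (X i)] {π : Measure (∀ i, X i)} [IsFiniteMeasure π]
    {κ : Kernel (∀ i, X i) Y} [IsMarkovKernel κ] {i : ι} {a b q : ℝ} (hb : 0 ≤ b) (hq : 0 ≤ q)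
    (hcoord : ∀ x x' : ∀ i, X i, (∀ j, j ≠ i → x j = x' j) →
      κ x ≤ ENNReal.ofReal (Real.exp a) • κ x')
    (hall : ∀ x x' : ∀ i, X i, κ x ≤ ENNReal.ofReal (Real.exp b) • κ x')
    {S S' : Set (X i)} (h0 : 0 < π (coordEvent i S)) (h0' : 0 < π (coordEvent i S'))
    (htv : tvDist (condOthers π i S) (condOthers π i S') ≤ q) :
    (cond π (coordEvent i S)).bind κ ≤
      ENNReal.ofReal (Real.exp a * (1 + q * (Real.exp b - 1))) •
        (cond π (coordEvent i S')).bind κ := by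
  classical
  have hP : IsProbabilityMeasure (cond π (coordEvent i S)) := cond_isProbabilityMeasure h0.ne'
  have hP' : IsProbabilityMeasure (cond π (coordEvent i S')) := cond_isProbabilityMeasure h0'.ne'
  let e := MeasurableEquiv.piEquivPiSubtypeProd X (fun j => j ≠ i)
  have hres : Measurable (fun (x : ∀ i, X i) (j : {j // j ≠ i}) => x j) :=
    measurable_pi_lambda _ fun j => measurable_pi_apply _
  have hO : IsProbabilityMeasure (condOthers π i S) :=
    Measure.isProbabilityMeasure_map hres.aemeasurable
  have hO' : IsProbabilityMeasure (condOthers π i S') :=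
    Measure.isProbabilityMeasure_map hres.aemeasurable
  -- The joint law of `(x_{-i}, x_i)` given `x_i ∈ S'`, to be disintegrated over `x_{-i}`.
  let ρ := (cond π (coordEvent i S')).map e
  have hρ : IsProbabilityMeasure ρ := Measure.isProbabilityMeasure_map e.measurable.aemeasurable
  have hfst : ρ.fst = condOthers π i S' := by
    rw [Measure.fst, Measure.map_map measurable_fst e.measurable]
    rfl
  refine Measure.le_iff.mpr fun R hR => ?_
  have hκR : Measurable fun x => κ x R := Kernel.measurable_coe κ hR
  let g : (∀ j : {j // j ≠ i}, X j) → ℝ≥0∞ := fun y => ∫⁻ s, κ (e.symm (y, s)) R ∂ρ.condKernel y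
  have hgm : Measurable g :=
    Measurable.lintegral_kernel_prod_right' (κ := ρ.condKernel)
      (f := fun z => κ (e.symm z) R) (hκR.comp e.symm.measurable)
  have hint : ∫⁻ x, κ x R ∂(cond π (coordEvent i S')) = ∫⁻ y, g y ∂(condOthers π i S') := by
    rw [← hfst, Measure.lintegral_condKernel (ρ := ρ) (f := fun z => κ (e.symm z) R)
      (hκR.comp e.symm.measurable), lintegral_map (f := fun z => κ (e.symm z) R)
      (hκR.comp e.symm.measurable) e.measurable]
    simp
  -- Resampling coordinate `i` from its law given `x_{-i}` and `x_i ∈ S'` costs `e^a`. This holds at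
  -- every `x`, so the conditional law under `x_i ∈ S` is never needed.
  have hpt : ∀ x, κ x R ≤ ENNReal.ofReal (Real.exp a) * g (fun j => x j) := fun x => by
    calc κ x R = ∫⁻ _, κ x R ∂ρ.condKernel (fun j => x j) := by simp
      _ ≤ ∫⁻ s, ENNReal.ofReal (Real.exp a) * κ (e.symm (fun j => x j, s)) R
            ∂ρ.condKernel (fun j => x j) := by
          refine lintegral_mono fun s => hcoord _ _ (fun j hj => ?_) R
          change _ = (Equiv.piEquivPiSubtypeProd (fun j => j ≠ i) X).symm _ j
          rw [Equiv.piEquivPiSubtypeProd_symm_apply]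
          simp [hj]
      _ = _ := lintegral_const_mul' _ _ ENNReal.ofReal_ne_top
  have hosc : ∀ y y', g y ≤ ENNReal.ofReal (Real.exp b) * g y' := fun y y' => by
    have h1 : ∀ s, κ (e.symm (y, s)) R ≤ ENNReal.ofReal (Real.exp b) * g y' := fun s => by
      calc κ (e.symm (y, s)) R = ∫⁻ _, κ (e.symm (y, s)) R ∂ρ.condKernel y' := by simp
        _ ≤ ∫⁻ s', ENNReal.ofReal (Real.exp b) * κ (e.symm (y', s')) R ∂ρ.condKernel y' :=
            lintegral_mono fun s' => hall _ _ R
        _ = _ := lintegral_const_mul' _ _ ENNReal.ofReal_ne_top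
    calc g y ≤ ∫⁻ _, ENNReal.ofReal (Real.exp b) * g y' ∂ρ.condKernel y :=
          lintegral_mono h1
      _ = _ := by simp
  have hg1 : ∀ y, g y ≤ 1 := fun y => by
    calc g y ≤ ∫⁻ _, 1 ∂ρ.condKernel y := lintegral_mono fun s => prob_le_one
      _ = 1 := by simp
  -- Measuring the oscillation of `g` from its infimum gives the increment `(e^b - 1) m`. As `m` is
  -- at most the integral of `g`, the additive total variation error becomes multiplicative.
  set m := ⨅ y, g y with hm
  have hmg : ∀ y, m ≤ g y := fun y => iInf_le _ y
  have hmtop : m ≠ ∞ := ne_top_of_le_ne_top ENNReal.one_ne_top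
    ((hmg fun j => Classical.arbitrary _).trans (hg1 _))
  have heb : (1 : ℝ) ≤ Real.exp b := Real.one_le_exp hb
  have hgD : ∀ y, g y ≤ m + ENNReal.ofReal (Real.exp b - 1) * m := fun y => by
    have h1 : g y ≤ ENNReal.ofReal (Real.exp b) * m := by
      rw [hm, ENNReal.mul_iInf_of_ne (by positivity) ENNReal.ofReal_ne_top]
      exact le_iInf fun y' => hosc y y'
    refine h1.trans (le_of_eq ?_)
    nth_rewrite 2 [← one_mul m]
    rw [← add_mul, ← ENNReal.ofReal_one, ← ENNReal.ofReal_add zero_le_one (by linarith)]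
    simp
  have hmint : m ≤ ∫⁻ y, g y ∂(condOthers π i S') := by
    calc m = ∫⁻ _, m ∂(condOthers π i S') := by simp
      _ ≤ _ := lintegral_mono hmg
  rw [Measure.smul_apply, Measure.bind_apply hR κ.measurable.aemeasurable,
    Measure.bind_apply hR κ.measurable.aemeasurable, hint, smul_eq_mul]
  calc ∫⁻ x, κ x R ∂(cond π (coordEvent i S))
      ≤ ∫⁻ x, ENNReal.ofReal (Real.exp a) * g (fun j => x j) ∂(cond π (coordEvent i S)) :=
        lintegral_mono hpt
    _ = ENNReal.ofReal (Real.exp a) * ∫⁻ y, g y ∂(condOthers π i S) := by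
        rw [lintegral_const_mul' _ _ ENNReal.ofReal_ne_top, condOthers, lintegral_map hgm hres]
    _ ≤ ENNReal.ofReal (Real.exp a) * (∫⁻ y, g y ∂(condOthers π i S') +
          ENNReal.ofReal q * (ENNReal.ofReal (Real.exp b - 1) * m)) := by
        gcongr
        exact lintegral_le_add_of_tvDist_le htv hgm
          (ENNReal.mul_ne_top ENNReal.ofReal_ne_top hmtop) hmg hgD
    _ ≤ ENNReal.ofReal (Real.exp a) * (∫⁻ y, g y ∂(condOthers π i S') +
          ENNReal.ofReal q * (ENNReal.ofReal (Real.exp b - 1) *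
            ∫⁻ y, g y ∂(condOthers π i S'))) := by
        gcongr
    _ = _ := by
        rw [ENNReal.ofReal_mul (Real.exp_pos a).le, ENNReal.ofReal_add zero_le_one
          (mul_nonneg hq (by linarith)), ENNReal.ofReal_mul hq, ENNReal.ofReal_one]
        ring

/-- Both sides are mixtures of output laws that pairwise differ by a factor of at most `e^b`; no
assumption on the prior enters. -/
theorem bind_cond_le_of_isLDP {π : Measure (∀ i, X i)} [IsFiniteMeasure π]
    {κ : Kernel (∀ i, X i) Y} [IsMarkovKernel κ] {i : ι} {b : ℝ} (h : IsLDP κ b)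
    {S S' : Set (X i)} (h0 : 0 < π (coordEvent i S)) (h0' : 0 < π (coordEvent i S')) :
    (cond π (coordEvent i S)).bind κ ≤
      ENNReal.ofReal (Real.exp b) • (cond π (coordEvent i S')).bind κ := by
  have hP : IsProbabilityMeasure (cond π (coordEvent i S)) := cond_isProbabilityMeasure h0.ne'
  have hP' : IsProbabilityMeasure (cond π (coordEvent i S')) := cond_isProbabilityMeasure h0'.ne'
  refine Measure.le_iff.mpr fun R hR => ?_
  rw [Measure.smul_apply, Measure.bind_apply hR κ.measurable.aemeasurable,
    Measure.bind_apply hR κ.measurable.aemeasurable, smul_eq_mul]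
  have hx : ∀ x, κ x R ≤ ENNReal.ofReal (Real.exp b) *
      ∫⁻ x', κ x' R ∂(cond π (coordEvent i S')) := fun x => by
    rw [← lintegral_const_mul' _ _ ENNReal.ofReal_ne_top]
    calc κ x R = ∫⁻ _, κ x R ∂(cond π (coordEvent i S')) := by simp
      _ ≤ _ := lintegral_mono fun x' => h R hR x x'
  calc _ ≤ ∫⁻ _, ENNReal.ofReal (Real.exp b) * ∫⁻ x', κ x' R ∂(cond π (coordEvent i S'))
        ∂(cond π (coordEvent i S)) := lintegral_mono hx
    _ = _ := by simp

end Coordinates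

/-! ## The levels -/

theorem sum_Iic_increment {p : ℕ} (c : Fin (p + 1) → ℝ) (i : Fin (p + 1)) :
    ∑ k ∈ Finset.Iic i, increment c k = c i := by
  induction i using Fin.induction with
  | zero =>
    have : Finset.Iic (0 : Fin (p + 1)) = {0} := by
      ext k; simp
    simp [this, increment]
  | succ i ih =>
    have : Finset.Iic i.succ = insert i.succ (Finset.Iic i.castSucc) := by
      ext k
      simp only [Finset.mem_Iic, Finset.mem_insert, Fin.le_def, Fin.ext_iff, Fin.val_succ,
        Fin.val_castSucc]
      omega
    rw [this, Finset.sum_insert (by simp [Fin.le_def]), ih, increment]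
    simp

theorem increment_half {p : ℕ} (c : Fin (p + 1) → ℝ) (k : Fin (p + 1)) :
    increment (fun i => c i / 2) k = increment c k / 2 := by
  refine Fin.cases ?_ (fun j => ?_) k
  · simp [increment]
  · simp [increment]
    ring

theorem increment_nonneg {p : ℕ} {c : Fin (p + 1) → ℝ} (hc0 : 0 ≤ c 0) (hc : Monotone c)
    (k : Fin (p + 1)) : 0 ≤ increment c k := by
  refine Fin.cases ?_ (fun j => ?_) k
  · simpa [increment] using hc0
  · simpa [increment, ← Fin.succ_castSucc] using hc (Fin.castSucc_lt_succ (i := j)).le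

section Levels

variable {p : ℕ} {δ : Fin (p + 1) → ℝ} {ε ζ q : ℝ}

theorem lastLevel_nonneg (hδ : ∀ i, 0 ≤ δ i) (hε : 0 ≤ ε) (hζ : 0 < ζ) (hq : 0 ≤ q) :
    0 ≤ lastLevel δ ε ζ q := by
  unfold lastLevel
  split_ifs with h
  · exact le_min (hδ _) hε
  · have hq' : 0 < q := lt_of_le_of_ne hq (Ne.symm h)
    refine le_min (Real.log_nonneg ?_) (le_min (hδ _) hε)
    rw [le_div_iff₀ hq']
    have := Real.one_le_exp (mul_nonneg hζ.le (le_min (hδ 0) hε))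
    linarith

theorem lastLevel_le : lastLevel δ ε ζ q ≤ min (δ (Fin.last p)) ε := by
  unfold lastLevel
  split_ifs
  · exact le_rfl
  · exact min_le_right _ _

theorem log_penalty_nonneg (hδ : ∀ i, 0 ≤ δ i) (hε : 0 ≤ ε) (hζ : 0 < ζ) (hq : 0 ≤ q) :
    0 ≤ Real.log (1 + q * Real.exp (lastLevel δ ε ζ q) - q) := by
  refine Real.log_nonneg ?_
  nlinarith [Real.one_le_exp (lastLevel_nonneg hδ hε hζ hq)]

/-- For `q > 0` the first term in the minimum defining `c_d` solves `1 + q(e^{c_d} - 1) = e^{ζ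
δ̃_1}`, so the penalty is at most `ζ δ̃_1 ≤ δ̃_1`. This keeps all levels nonnegative. -/
theorem log_penalty_le (hδ : ∀ i, 0 ≤ δ i) (hε : 0 ≤ ε) (hζ : 0 < ζ) (hζ1 : ζ ≤ 1)
    (hq : 0 ≤ q) :
    Real.log (1 + q * Real.exp (lastLevel δ ε ζ q) - q) ≤ min (δ 0) ε := by
  have hm : 0 ≤ min (δ 0) ε := le_min (hδ 0) hε
  rcases eq_or_lt_of_le hq with rfl | hq'
  · simpa using hm
  have h1 := Real.one_le_exp (lastLevel_nonneg hδ hε hζ hq)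
  have h2 := Real.one_le_exp (mul_nonneg hζ.le hm)
  have h3 : lastLevel δ ε ζ q ≤ Real.log ((Real.exp (ζ * min (δ 0) ε) + q - 1) / q) := by
    rw [lastLevel, if_neg hq'.ne']
    exact min_le_left _ _
  have h4 : Real.exp (lastLevel δ ε ζ q) ≤ (Real.exp (ζ * min (δ 0) ε) + q - 1) / q := by
    rwa [Real.le_log_iff_exp_le (div_pos (by linarith) hq')] at h3
  rw [le_div_iff₀ hq'] at h4
  rw [Real.log_le_iff_le_exp (by nlinarith)]
  calc 1 + q * Real.exp (lastLevel δ ε ζ q) - q ≤ Real.exp (ζ * min (δ 0) ε) := by linarith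
    _ ≤ Real.exp (min (δ 0) ε) := by
      gcongr
      nlinarith

theorem levels_last : levels δ ε ζ q (Fin.last p) = lastLevel δ ε ζ q := by simp [levels]

theorem levels_le_last (hδ : ∀ i, 0 ≤ δ i) (hε : 0 ≤ ε) (hζ : 0 < ζ) (hq : 0 ≤ q)
    (i : Fin (p + 1)) : levels δ ε ζ q i ≤ lastLevel δ ε ζ q := by
  have := log_penalty_nonneg hδ hε hζ hq
  unfold levels
  split_ifs <;> linarith

theorem levels_nonneg (hδ : ∀ i, 0 ≤ δ i) (hmono : Monotone δ) (hε : 0 ≤ ε) (hζ : 0 < ζ)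
    (hζ1 : ζ ≤ 1) (hq : 0 ≤ q) (i : Fin (p + 1)) : 0 ≤ levels δ ε ζ q i := by
  have h1 := lastLevel_nonneg hδ hε hζ hq
  have h2 := log_penalty_le hδ hε hζ hζ1 hq
  have h3 : min (δ 0) ε ≤ min (δ i) ε := min_le_min_right _ (hmono (Fin.zero_le i))
  unfold levels
  split_ifs <;> linarith

theorem monotone_levels (hδ : ∀ i, 0 ≤ δ i) (hmono : Monotone δ) (hε : 0 ≤ ε) (hζ : 0 < ζ)
    (hq : 0 ≤ q) : Monotone (levels δ ε ζ q) := by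
  intro i j hij
  by_cases hj : j = Fin.last p
  · rw [hj, levels_last]
    exact levels_le_last hδ hε hζ hq i
  have hi : i ≠ Fin.last p := fun h => hj (Fin.last_le_iff.mp (h ▸ hij))
  have h1 := log_penalty_nonneg hδ hε hζ hq
  have h3 : min (δ i) ε ≤ min (δ j) ε := min_le_min_right _ (hmono hij)
  unfold levels
  rw [if_neg hi, if_neg hj]
  split_ifs <;> linarith

end Levels

/-! ## Privacy of the mean-estimation mechanism -/

section Mechanism

variable {M : ChannelFamily} {p : ℕ} {c : Fin (p + 1) → ℝ}

theorem tailVec_congr {k : Fin (p + 1)} {x x' : DataCube p} (h : ∀ j, k ≤ j → x j = x' j) :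
    tailVec k x = tailVec k x' := by
  unfold tailVec
  congr 1
  funext j
  rw [h _ (by simp [Fin.le_def])]

theorem tailChannel_le (hM : M.IsLDP) {k : Fin (p + 1)} (hk : 0 ≤ increment c k)
    (x x' : DataCube p) :
    tailChannel M c k x ≤ ENNReal.ofReal (Real.exp (increment c k)) • tailChannel M c k x' := by
  refine isLDP_iff.mp (hM _ _ _ hk (Real.sqrt_pos.mpr ?_)) _ _
  positivity

theorem tailChannel_congr {k : Fin (p + 1)} {x x' : DataCube p}
    (h : ∀ j, k ≤ j → x j = x' j) : tailChannel M c k x = tailChannel M c k x' := by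
  simp only [tailChannel, Kernel.comap_apply, tailVec_congr h]

/-- If `x` and `x'` agree beyond coordinate `i`, then the laws of the output differ by a factor at
most `e^{c_i}`. -/
theorem meanMechanism_le (hM : M.IsLDP) (hc : ∀ k, 0 ≤ increment c k) {i : Fin (p + 1)}
    {x x' : DataCube p} (h : ∀ j, i < j → x j = x' j) :
    meanMechanism M c x ≤ ENNReal.ofReal (Real.exp (c i)) • meanMechanism M c x' := by
  rw [meanMechanism, Kernel.map_apply _ (measurable_aggregate c),
    Kernel.map_apply _ (measurable_aggregate c)]
  refine Measure.map_le_smul_map ?_ (measurable_aggregate c)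
  -- Channels with `k > i` see the same input under `x` and `x'` and cost nothing; the increments of
  -- the others telescope to `c_i`.
  have hprod : ∏ k, (if k ≤ i then ENNReal.ofReal (Real.exp (increment c k)) else 1) =
      ENNReal.ofReal (Real.exp (c i)) := by
    rw [← sum_Iic_increment c i, Real.exp_sum,
      ENNReal.ofReal_prod_of_nonneg fun k _ => (Real.exp_pos _).le, ← Finset.prod_filter]
    congr 1
    ext k
    simp
  rw [← hprod]
  change Measure.pi _ ≤ _ • Measure.pi _
  refine Measure.pi_le_smul_pi (fun k => by split_ifs <;> simp) fun k => ?_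
  split_ifs with hk
  · exact tailChannel_le hM (hc k) x x'
  · rw [one_smul, tailChannel_congr fun j hj => h j ((not_le.mp hk).trans_le hj)]

theorem userReport_le (hM : M.IsLDP) (hc : ∀ k, 0 ≤ increment c k) {i : Fin (p + 1)}
    {x x' : DataCube p} (h : ∀ j, i < j → x j = x' j) :
    userReport M c x ≤ ENNReal.ofReal (Real.exp (c i)) • userReport M c x' := by
  have hc' : ∀ k, 0 ≤ increment (fun i => c i / 2) k := fun k => by
    rw [increment_half]
    linarith [hc k]
  have h1 := meanMechanism_le hM hc' h
  have hexp : ENNReal.ofReal (Real.exp (c i)) =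
      ENNReal.ofReal (Real.exp (c i / 2)) * ENNReal.ofReal (Real.exp (c i / 2)) := by
    rw [← ENNReal.ofReal_mul (Real.exp_pos _).le, ← Real.exp_add, add_halves]
  rw [userReport, Kernel.prod_apply, Kernel.prod_apply, hexp]
  refine (Measure.prod_mono h1 h1).trans ?_
  rw [Measure.prod_smul_left, Measure.prod_smul_right, smul_smul]

theorem isLDP_userReport (hM : M.IsLDP) (hc : ∀ k, 0 ≤ increment c k) :
    IsLDP (userReport M c) (c (Fin.last p)) :=
  isLDP_iff.mpr fun _ _ => userReport_le hM hc fun j hj =>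
    absurd (Fin.le_last j) (not_le.mpr hj)

/-- Either the overall LDP level `c_d` is already within `δ_i`, or `c_i` has been lowered by exactly
the price of the dependence between the coordinates. -/
theorem isBCDP_userReport (hM : M.IsLDP) {δ : Fin (p + 1) → ℝ} {ε ζ q : ℝ}
    (hδ : ∀ i, 0 ≤ δ i) (hmono : Monotone δ) (hε : 0 ≤ ε) (hζ : 0 < ζ) (hζ1 : ζ ≤ 1) (hq : 0 ≤ q)
    {π : Measure (DataCube p)} [IsProbabilityMeasure π]
    (hπ : ∀ (i : Fin (p + 1)), i ≠ Fin.last p → ∀ S S' : Set (Icc (-1 : ℝ) 1),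
      MeasurableSet S → MeasurableSet S' → 0 < π (coordEvent i S) → 0 < π (coordEvent i S') →
      tvDist (condOthers π i S) (condOthers π i S') ≤ q) :
    IsBCDP π (userReport M (levels δ ε ζ q)) δ := by
  have hc := increment_nonneg (levels_nonneg hδ hmono hε hζ hζ1 hq 0)
    (monotone_levels hδ hmono hε hζ hq)
  have hL := isLDP_userReport hM hc
  have hlast := lastLevel_nonneg hδ hε hζ hq
  rw [isBCDP_iff]
  intro i S S' hS hS' h0 h0'
  by_cases hi : lastLevel δ ε ζ q ≤ δ i
  · refine bind_cond_le_of_isLDP (hL.mono ?_) h0 h0'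
    rwa [levels_last]
  -- Since `c_d ≤ δ_d`, the label always falls in the first case; hence the dependence bound is
  -- needed for features only.
  have hne : i ≠ Fin.last p := by
    rintro rfl
    exact hi (lastLevel_le.trans (min_le_left _ _))
  have hlev : levels δ ε ζ q i =
      min (δ i) ε - Real.log (1 + q * Real.exp (lastLevel δ ε ζ q) - q) := by
    rw [levels, if_neg hne, if_neg fun h => hi (h.trans (min_le_left _ _))]
  have : Nonempty (Icc (-1 : ℝ) 1) := ⟨⟨0, by simp⟩⟩
  have hcoord := bind_cond_coordEvent_le (κ := userReport M (levels δ ε ζ q)) (i := i)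
    (a := levels δ ε ζ q i) hlast hq
    (fun x x' h => userReport_le hM hc fun j hj => h j hj.ne')
    (fun x x' => by rw [← levels_last]; exact isLDP_iff.mp hL x x') h0 h0'
    (hπ i hne S S' hS hS' h0 h0')
  refine hcoord.trans (Measure.le_iff'.mpr fun R => ?_)
  rw [Measure.smul_apply, Measure.smul_apply]
  have hpos : 0 < 1 + q * Real.exp (lastLevel δ ε ζ q) - q := by
    nlinarith [Real.one_le_exp hlast]
  gcongr
  rw [hlev, Real.exp_sub, Real.exp_log hpos]
  calc _ = Real.exp (min (δ i) ε) := by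
        have : 1 + q * (Real.exp (lastLevel δ ε ζ q) - 1) =
          1 + q * Real.exp (lastLevel δ ε ζ q) - q := by ring
        rw [this, div_mul_cancel₀ _ hpos.ne']
    _ ≤ Real.exp (δ i) := Real.exp_le_exp.mpr (min_le_left _ _)

/-! ## Privacy of the least squares estimator -/

/-- All reports, given the report of user `j` and the data `x` of the other users. -/
noncomputable def insertReport (M : ChannelFamily) {n p : ℕ} (c : Fin (p + 1) → ℝ)
    (x : Fin n → DataCube p) (j : Fin n) :
    Kernel (EuclideanSpace ℝ (Fin (p + 1)) × EuclideanSpace ℝ (Fin (p + 1))) (Reports n p) :=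
  have : ∀ i, IsMarkovKernel (if i = j then Kernel.id
      else Kernel.const _ (userReport M c (x i))) := fun i => by
    split_ifs <;> infer_instance
  prodKernel fun i => if i = j then Kernel.id else Kernel.const _ (userReport M c (x i))

instance {n : ℕ} (x : Fin n → DataCube p) (j : Fin n) : IsMarkovKernel (insertReport M c x j) := by
  unfold insertReport; infer_instance

/-- With the other users' data fixed, the data of user `j` reach the server only through that user's
own report. The output is therefore a post-processing of this report. -/
theorem allReports_update {n : ℕ} (x : Fin n → DataCube p) (j : Fin n) (y : DataCube p) :
    allReports M n c (Function.update x j y) = (userReport M c y).bind (insertReport M c x j) := by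
  change Measure.pi _ = _
  refine Measure.pi_eq fun s hs => ?_
  rw [Measure.bind_apply (.univ_pi hs) (insertReport M c x j).measurable.aemeasurable]
  have hK : ∀ t, insertReport M c x j t (Set.pi univ s) =
      (s j).indicator 1 t * ∏ i ∈ Finset.univ.erase j, userReport M c (x i) (s i) := fun t => by
    have : ∀ i, IsMarkovKernel (if i = j then Kernel.id
        else Kernel.const (EuclideanSpace ℝ (Fin (p + 1)) × EuclideanSpace ℝ (Fin (p + 1)))
          (userReport M c (x i))) := fun i => by
      split_ifs <;> infer_instance
    change Measure.pi _ _ = _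
    rw [Measure.pi_pi, ← Finset.mul_prod_erase _ _ (Finset.mem_univ j)]
    simp only [if_true]
    rw [Kernel.id_apply, Measure.dirac_apply' _ (hs j)]
    congr 1
    refine Finset.prod_congr rfl fun i hi => ?_
    rw [if_neg (Finset.ne_of_mem_erase hi), Kernel.const_apply]
  simp_rw [hK]
  rw [lintegral_mul_const _ (measurable_one.indicator (hs j)), lintegral_indicator_one (hs j),
    ← Finset.mul_prod_erase _ _ (Finset.mem_univ j)]
  congr 1
  · simp [Kernel.comap_apply]
  · refine Finset.prod_congr rfl fun i hi => ?_
    simp [Kernel.comap_apply, Function.update_of_ne (Finset.ne_of_mem_erase hi)]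

theorem lseMechanismAt_eq_comp {n : ℕ} (opt : Kernel (Reports n p) (EuclideanSpace ℝ (Fin p)))
    (x : Fin n → DataCube p) (j : Fin n) :
    lseMechanismAt M c opt x j = (opt ∘ₖ insertReport M c x j) ∘ₖ userReport M c := by
  ext1 y
  rw [lseMechanismAt, lseMechanism, Kernel.comap_apply, Kernel.comp_apply, allReports_update,
    Kernel.comp_assoc, Kernel.comp_apply, Kernel.comp_apply]

end Mechanism

theorem userReport_and_lseMechanismAt_private (M : ChannelFamily) (hM : M.IsLDP) (n p : ℕ) (δ : Fin (p + 1) → ℝ) (ε ζ q : ℝ)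
    (hδ : ∀ i, 0 ≤ δ i) (hmono : Monotone δ) (hε : 0 ≤ ε) (hζ : 0 < ζ) (hζ1 : ζ ≤ 1) (hq : 0 ≤ q)
    (π : Measure (DataCube p)) [IsProbabilityMeasure π]
    (hπ : ∀ (i : Fin (p + 1)), i ≠ Fin.last p → ∀ S S' : Set (Icc (-1 : ℝ) 1),
      MeasurableSet S → MeasurableSet S' → 0 < π (coordEvent i S) → 0 < π (coordEvent i S') →
      tvDist (condOthers π i S) (condOthers π i S') ≤ q)
    (opt : Kernel (Reports n p) (EuclideanSpace ℝ (Fin p))) [IsMarkovKernel opt] (j : Fin n) :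
    IsBCDP π (userReport M (levels δ ε ζ q)) δ ∧
    IsLDP (userReport M (levels δ ε ζ q)) ε ∧
    ∀ x : Fin n → DataCube p,
      IsBCDP π (lseMechanismAt M (levels δ ε ζ q) opt x j) δ ∧
      IsLDP (lseMechanismAt M (levels δ ε ζ q) opt x j) ε := by
  have hB := isBCDP_userReport hM hδ hmono hε hζ hζ1 hq hπ
  have hL : IsLDP (userReport M (levels δ ε ζ q)) ε := by
    refine (isLDP_userReport hM (increment_nonneg (levels_nonneg hδ hmono hε hζ hζ1 hq 0)
      (monotone_levels hδ hmono hε hζ hq))).mono ?_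
    rw [levels_last]
    exact lastLevel_le.trans (min_le_right _ _)
  refine ⟨hB, hL, fun x => ?_⟩
  rw [lseMechanismAt_eq_comp]
  exact ⟨hB.comp _, hL.comp _⟩

/-! ## The surface measure of the sphere -/

section Sphere

open scoped Pointwise

/-- Surface measure is read off from the Lebesgue measure of cones, so invariance under isometries
and null sets are inherited from `volume`. -/
theorem sphereMeasure_apply {m : ℕ} {A : Set (EuclideanSpace ℝ (Fin m))} (hA : MeasurableSet A) :
    sphereMeasure m A = m * volume (Ioo (0 : ℝ) 1 • (A ∩ sphere 0 1)) := by
  rw [sphereMeasure, Measure.map_apply measurable_subtype_coe hA,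
    Measure.toSphere_apply' _ (measurable_subtype_coe hA), Subtype.image_preimage_coe,
    finrank_euclideanSpace_fin, inter_comm]

theorem measurePreserving_sphereMeasure {m : ℕ}
    (L : EuclideanSpace ℝ (Fin m) ≃ₗᵢ[ℝ] EuclideanSpace ℝ (Fin m)) :
    MeasurePreserving L (sphereMeasure m) (sphereMeasure m) := by
  refine ⟨L.continuous.measurable, Measure.ext fun A hA => ?_⟩
  rw [Measure.map_apply L.continuous.measurable hA,
    sphereMeasure_apply (L.continuous.measurable hA), sphereMeasure_apply hA]
  have : Ioo (0 : ℝ) 1 • (L ⁻¹' A ∩ sphere 0 1) = L ⁻¹' (Ioo (0 : ℝ) 1 • (A ∩ sphere 0 1)) := by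
    ext x
    simp only [mem_smul, mem_preimage, mem_inter_iff, mem_sphere_zero_iff_norm]
    constructor
    · rintro ⟨r, hr, y, ⟨hy, hy1⟩, rfl⟩
      exact ⟨r, hr, L y, ⟨hy, by rw [L.norm_map, hy1]⟩, by simp⟩
    · rintro ⟨r, hr, y, ⟨hy, hy1⟩, hxy⟩
      refine ⟨r, hr, L.symm y, ⟨by simpa using hy, by rw [L.symm.norm_map, hy1]⟩, ?_⟩
      rw [← map_smul, hxy, L.symm_apply_apply]
  rw [this, L.measurePreserving.measure_preimage_emb L.toHomeomorph.measurableEmbedding]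

theorem integral_sphereMeasure_comp {m : ℕ}
    (L : EuclideanSpace ℝ (Fin m) ≃ₗᵢ[ℝ] EuclideanSpace ℝ (Fin m))
    (f : EuclideanSpace ℝ (Fin m) → ℝ) :
    ∫ z, f (L z) ∂(sphereMeasure m) = ∫ z, f z ∂(sphereMeasure m) :=
  (measurePreserving_sphereMeasure L).integral_comp L.toHomeomorph.measurableEmbedding f

/-- The cone over the equator lies in the orthogonal complement of `u`, a proper subspace and hence
Lebesgue null. -/
theorem sphereMeasure_equator {m : ℕ} {u : EuclideanSpace ℝ (Fin m)} (hu : u ≠ 0) :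
    sphereMeasure m {z | inner ℝ z u = 0} = 0 := by
  have hm : MeasurableSet {z : EuclideanSpace ℝ (Fin m) | inner ℝ z u = 0} :=
    (isClosed_eq (continuous_id.inner continuous_const) continuous_const).measurableSet
  have hnull : volume ((ℝ ∙ u)ᗮ : Set (EuclideanSpace ℝ (Fin m))) = 0 := by
    refine Measure.addHaar_submodule _ _ fun h => hu ?_
    have : u ∈ (ℝ ∙ u)ᗮ := h ▸ Submodule.mem_top
    exact inner_self_eq_zero.mp (Submodule.mem_orthogonal_singleton_iff_inner_right.mp this)
  rw [sphereMeasure_apply hm, measure_mono_null ?_ hnull, mul_zero]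
  rintro x ⟨r, -, y, ⟨hy, -⟩, rfl⟩
  rw [SetLike.mem_coe, Submodule.mem_orthogonal_singleton_iff_inner_left]
  change inner ℝ (r • y) u = 0
  rw [inner_smul_left, show inner ℝ y u = 0 from hy, mul_zero]

theorem ae_norm_eq_one_sphereMeasure (m : ℕ) : ∀ᵐ z ∂(sphereMeasure m), ‖z‖ = 1 := by
  rw [sphereMeasure, ae_map_iff measurable_subtype_coe.aemeasurable
    (measurableSet_eq_fun measurable_norm measurable_const)]
  exact .of_forall fun z => by simp

theorem measurableSet_hemisphere {m : ℕ} (u : EuclideanSpace ℝ (Fin m)) :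
    MeasurableSet {z : EuclideanSpace ℝ (Fin m) | 0 < inner ℝ z u} :=
  (isOpen_lt continuous_const (continuous_id.inner continuous_const)).measurableSet

theorem disjoint_hemisphere_neg {m : ℕ} (u : EuclideanSpace ℝ (Fin m)) :
    Disjoint {z : EuclideanSpace ℝ (Fin m) | 0 < inner ℝ z u} {z | 0 < inner ℝ z (-u)} := by
  rw [Set.disjoint_left]
  intro z (h1 : 0 < inner ℝ z u) (h2 : 0 < inner ℝ z (-u))
  rw [inner_neg_right] at h2
  linarith

theorem sphereMeasure_restrict_add_restrict_neg {m : ℕ} {u : EuclideanSpace ℝ (Fin m)}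
    (hu : u ≠ 0) :
    (sphereMeasure m).restrict {z | 0 < inner ℝ z u} +
      (sphereMeasure m).restrict {z | 0 < inner ℝ z (-u)} = sphereMeasure m := by
  rw [← Measure.restrict_union (disjoint_hemisphere_neg u) (measurableSet_hemisphere _)]
  refine Measure.restrict_eq_self_of_ae_mem ?_
  have : ∀ᵐ z ∂(sphereMeasure m), ¬ inner ℝ z u = 0 := by
    rw [ae_iff]
    simpa using sphereMeasure_equator hu
  filter_upwards [this] with z hz
  rcases lt_or_gt_of_ne hz with h | h
  · right
    simpa using h
  · exact Or.inl h

theorem sphereMeasure_hemisphere_neg {m : ℕ} (u : EuclideanSpace ℝ (Fin m)) :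
    sphereMeasure m {z | 0 < inner ℝ z (-u)} = sphereMeasure m {z | 0 < inner ℝ z u} := by
  rw [← (measurePreserving_sphereMeasure (LinearIsometryEquiv.neg ℝ)).measure_preimage
    (measurableSet_hemisphere u).nullMeasurableSet]
  congr 1
  ext z
  simp

theorem two_mul_sphereMeasure_hemisphere {m : ℕ} {u : EuclideanSpace ℝ (Fin m)} (hu : u ≠ 0) :
    2 * sphereMeasure m {z | 0 < inner ℝ z u} = sphereMeasure m univ := by
  nth_rewrite 2 [← sphereMeasure_restrict_add_restrict_neg hu]
  rw [Measure.add_apply, Measure.restrict_apply_univ, Measure.restrict_apply_univ,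
    sphereMeasure_hemisphere_neg, two_mul]

theorem sphereMeasure_univ_ne_zero (m : ℕ) : sphereMeasure (m + 1) univ ≠ 0 := by
  have hu : (EuclideanSpace.single 0 1 : EuclideanSpace ℝ (Fin (m + 1))) ≠ 0 := by simp
  exact fun h => sphereMeasure_hemisphere_ne_zero hu (measure_mono_null (subset_univ _) h)

/-- Twice the uniform distribution on the sphere of radius `B`. -/
noncomputable def doubledUniform (m : ℕ) (B : ℝ) : Measure (EuclideanSpace ℝ (Fin m)) :=
  (2 * (sphereMeasure m univ)⁻¹) • (sphereMeasure m).map (fun z => B • z)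

/-- Antipodal symmetry and the null equator give every hemisphere half the total mass, so the
normalizing constant does not depend on `u`. -/
theorem uniformHemisphere_eq {m : ℕ} (B : ℝ) {u : EuclideanSpace ℝ (Fin m)} (hu : u ≠ 0) :
    uniformHemisphere m B u = (2 * (sphereMeasure m univ)⁻¹) •
      ((sphereMeasure m).restrict {z | 0 < inner ℝ z u}).map (fun z => B • z) := by
  have : 2 * (sphereMeasure m univ)⁻¹ = (sphereMeasure m {z | 0 < inner ℝ z u})⁻¹ := by
    rw [← two_mul_sphereMeasure_hemisphere hu, ENNReal.mul_inv (by simp) (by simp), ← mul_assoc,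
      ENNReal.mul_inv_cancel (by simp) (by simp), one_mul]
  rw [this, uniformHemisphere, ProbabilityTheory.cond, Measure.map_smul]

/-- The right-hand side does not involve `u`: it is the reference measure against which all output
laws of the channel are compared. -/
theorem uniformHemisphere_add_neg {m : ℕ} (B : ℝ) {u : EuclideanSpace ℝ (Fin m)} (hu : u ≠ 0) :
    uniformHemisphere m B u + uniformHemisphere m B (-u) = doubledUniform m B := by
  rw [uniformHemisphere_eq B hu, uniformHemisphere_eq B (neg_ne_zero.mpr hu), ← smul_add,
    ← Measure.map_add _ _ (measurable_const_smul B), sphereMeasure_restrict_add_restrict_neg hu,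
    doubledUniform]

/-! ## Privacy of the sphere channel -/

theorem bernWeight_logistic_false (α : ℝ) :
    bernWeight (Real.exp α / (Real.exp α + 1)) false = ENNReal.ofReal (1 / (Real.exp α + 1)) := by
  have : (0 : ℝ) < Real.exp α + 1 := by positivity
  simp only [bernWeight, Bool.false_eq_true, if_false]
  congr 1
  field_simp
  ring

theorem bernWeight_logistic_true (α : ℝ) :
    bernWeight (Real.exp α / (Real.exp α + 1)) true =
      ENNReal.ofReal (Real.exp α) * bernWeight (Real.exp α / (Real.exp α + 1)) false := by
  rw [bernWeight_logistic_false, ← ENNReal.ofReal_mul (Real.exp_pos _).le]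
  simp only [bernWeight, if_true]
  rw [mul_one_div]

theorem bernWeight_logistic_false_le {α : ℝ} (hα : 0 ≤ α) :
    bernWeight (Real.exp α / (Real.exp α + 1)) false ≤
      bernWeight (Real.exp α / (Real.exp α + 1)) true := by
  rw [bernWeight_logistic_true]
  exact le_mul_of_one_le_left' (by
    rw [ENNReal.one_le_ofReal]
    exact Real.one_le_exp hα)

theorem sphereChannelLaw_eq {m : ℕ} (α r : ℝ) (v : EuclideanSpace ℝ (Fin (m + 1))) :
    sphereChannelLaw m α r v =
      (bernWeight (Real.exp α / (Real.exp α + 1)) true * bernWeight (1 / 2 + ‖v‖ / (2 * r)) true +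
        bernWeight (Real.exp α / (Real.exp α + 1)) false *
          bernWeight (1 / 2 + ‖v‖ / (2 * r)) false) •
        uniformHemisphere (m + 1) (sphereRadius (m + 1) α r) (unitDir v) +
      (bernWeight (Real.exp α / (Real.exp α + 1)) true * bernWeight (1 / 2 + ‖v‖ / (2 * r)) false +
        bernWeight (Real.exp α / (Real.exp α + 1)) false *
          bernWeight (1 / 2 + ‖v‖ / (2 * r)) true) •
        uniformHemisphere (m + 1) (sphereRadius (m + 1) α r) (-unitDir v) := by
  simp only [sphereChannelLaw, Fintype.sum_bool, boolSign, if_true, Bool.false_eq_true, if_false,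
    add_smul]
  simp only [mul_one, one_smul, mul_neg, neg_neg, neg_smul]
  abel

theorem sum_bernWeight_of_mem {m : ℕ} {r : ℝ} {v : EuclideanSpace ℝ (Fin (m + 1))}
    (hv : v ∈ closedBall 0 r) :
    bernWeight (1 / 2 + ‖v‖ / (2 * r)) true + bernWeight (1 / 2 + ‖v‖ / (2 * r)) false = 1 := by
  have hv' : ‖v‖ ≤ r := by simpa using hv
  have hr : 0 ≤ r := (norm_nonneg v).trans hv'
  rw [← sum_bernWeight (p := 1 / 2 + ‖v‖ / (2 * r)) (by positivity), Fintype.sum_bool]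
  have : ‖v‖ / (2 * r) ≤ 1 / 2 := by
    rw [mul_comm, ← div_div]
    have := div_le_one_of_le₀ hv' hr
    linarith
  linarith

/-- The weight of either hemisphere is an average, over `S`, of the two probabilities of `K`, hence
at most the larger one. The lower bound `le_sphereChannelLaw` uses the smaller one in the same way.
-/
theorem sphereChannelLaw_le {m : ℕ} {α r : ℝ} (hα : 0 ≤ α) {v : EuclideanSpace ℝ (Fin (m + 1))}
    (hv : v ∈ closedBall 0 r) :
    sphereChannelLaw m α r v ≤ bernWeight (Real.exp α / (Real.exp α + 1)) true •
      doubledUniform (m + 1) (sphereRadius (m + 1) α r) := by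
  have hS := sum_bernWeight_of_mem hv
  have hS' := (add_comm _ _).trans hS
  have hK := bernWeight_logistic_false_le hα
  rw [sphereChannelLaw_eq, ← uniformHemisphere_add_neg _ (unitDir_ne_zero v), smul_add]
  refine Measure.le_iff'.mpr fun A => ?_
  simp only [Measure.add_apply, Measure.smul_apply, smul_eq_mul]
  gcongr
  · grw [hK]
    rw [← mul_add, hS, mul_one]
  · grw [hK]
    rw [← mul_add, hS', mul_one]

theorem le_sphereChannelLaw {m : ℕ} {α r : ℝ} (hα : 0 ≤ α) {v : EuclideanSpace ℝ (Fin (m + 1))}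
    (hv : v ∈ closedBall 0 r) :
    bernWeight (Real.exp α / (Real.exp α + 1)) false •
      doubledUniform (m + 1) (sphereRadius (m + 1) α r) ≤ sphereChannelLaw m α r v := by
  have hS := sum_bernWeight_of_mem hv
  have hS' := (add_comm _ _).trans hS
  have hK := bernWeight_logistic_false_le hα
  rw [sphereChannelLaw_eq, ← uniformHemisphere_add_neg _ (unitDir_ne_zero v), smul_add]
  refine Measure.le_iff'.mpr fun A => ?_
  simp only [Measure.add_apply, Measure.smul_apply, smul_eq_mul]
  gcongr
  · grw [← hK]
    rw [← mul_add, hS, mul_one]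
  · grw [← hK]
    rw [← mul_add, hS', mul_one]

theorem isLDP_sphereChannel : sphereChannel.IsLDP := by
  intro m α r hα _
  rw [isLDP_iff]
  intro v v'
  refine (sphereChannelLaw_le hα v.2).trans ?_
  rw [bernWeight_logistic_true, mul_smul]
  exact Measure.le_iff'.mpr fun A => mul_le_mul_right (le_sphereChannelLaw hα v'.2 A) _

end Sphere

/-! ## Moments of the surface measure -/

section SphereMoments

/-- Integration in polar coordinates for products of an angular and a radial function. -/
theorem integral_polar (m : ℕ) (f : EuclideanSpace ℝ (Fin (m + 1)) → ℝ) (g : ℝ → ℝ) :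
    ∫ x, f (‖x‖⁻¹ • x) * g ‖x‖ = (∫ z, f z ∂(sphereMeasure (m + 1))) *
      ∫ t in Ioi (0 : ℝ), t ^ m * g t := by
  let E := EuclideanSpace ℝ (Fin (m + 1))
  have hdim : Module.finrank ℝ E - 1 = m := by simp [E]
  calc ∫ x : E, f (‖x‖⁻¹ • x) * g ‖x‖
      = ∫ x : ({(0 : E)}ᶜ : Set E), f (‖x.1‖⁻¹ • x.1) * g ‖x.1‖ ∂(volume.comap Subtype.val) := by
        rw [integral_subtype_comap (measurableSet_singleton _).compl
          fun x : E => f (‖x‖⁻¹ • x) * g ‖x‖, restrict_compl_singleton]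
    _ = ∫ x : sphere (0 : E) 1 × Ioi (0 : ℝ), f x.1 * g x.2
          ∂((volume : Measure E).toSphere.prod (.volumeIoiPow (Module.finrank ℝ E - 1))) := by
        rw [← (volume : Measure E).measurePreserving_homeomorphUnitSphereProd.integral_comp
          (Homeomorph.measurableEmbedding _)]
        simp
    _ = (∫ z, f z.1 ∂(volume : Measure E).toSphere) *
          ∫ t : Ioi (0 : ℝ), g t ∂(.volumeIoiPow m) := by
        rw [hdim]
        exact integral_prod_mul (fun z : sphere (0 : E) 1 => f z) (fun t : Ioi (0 : ℝ) => g t)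
    _ = _ := by
        congr 1
        · rw [sphereMeasure, (MeasurableEmbedding.subtype_coe
            isClosed_sphere.measurableSet).integral_map]
        · simp only [Measure.volumeIoiPow, ENNReal.ofReal]
          rw [integral_withDensity_eq_integral_smul
            (measurable_subtype_coe.pow_const _).real_toNNReal,
            integral_subtype_comap measurableSet_Ioi fun a ↦ Real.toNNReal (a ^ m) • g a]
          refine setIntegral_congr_fun measurableSet_Ioi fun x hx ↦ ?_
          rw [NNReal.smul_def, Real.coe_toNNReal _ (pow_nonneg (le_of_lt hx) _), smul_eq_mul]

theorem integral_pow_mul_exp_neg_sq (m : ℕ) :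
    ∫ t in Ioi (0 : ℝ), t ^ m * Real.exp (-t ^ 2) = 1 / 2 * Real.Gamma (((m : ℝ) + 1) / 2) := by
  have h := integral_rpow_mul_exp_neg_rpow (p := 2) (q := m) two_pos
    (by have : (0 : ℝ) ≤ m := m.cast_nonneg; linarith)
  rw [← h]
  refine setIntegral_congr_fun measurableSet_Ioi fun t ht => ?_
  simp [Real.rpow_natCast]

theorem integral_abs_mul_exp_neg_sq : ∫ t : ℝ, |t| * Real.exp (-t ^ 2) = 1 := by
  have h := integral_comp_abs (f := fun t => t * Real.exp (-t ^ 2))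
  simp only [sq_abs] at h
  rw [h]
  have h1 := integral_pow_mul_exp_neg_sq 1
  simp only [pow_one] at h1
  rw [h1]
  norm_num

theorem integral_exp_neg_sq : ∫ t : ℝ, Real.exp (-t ^ 2) = √Real.pi := by
  simpa using integral_gaussian 1

theorem integral_exp_neg_norm_sq (m : ℕ) :
    ∫ x : EuclideanSpace ℝ (Fin m), Real.exp (-‖x‖ ^ 2) = √Real.pi ^ m := by
  rw [← (PiLp.volume_preserving_toLp (Fin m)).integral_comp
    (MeasurableEquiv.toLp 2 _).measurableEmbedding]
  have : ∀ x : Fin m → ℝ, Real.exp (-‖WithLp.toLp 2 x‖ ^ 2) = ∏ i, Real.exp (-(x i) ^ 2) := by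
    intro x
    rw [EuclideanSpace.norm_sq_eq, ← Real.exp_sum]
    simp
  simp_rw [this]
  rw [integral_fintype_prod_volume_eq_prod (fun _ : Fin m => fun t : ℝ => Real.exp (-t ^ 2))]
  simp [integral_exp_neg_sq]

theorem integral_abs_coord_mul_exp_neg_norm_sq (m : ℕ) :
    ∫ x : EuclideanSpace ℝ (Fin (m + 1)), |x 0| * Real.exp (-‖x‖ ^ 2) = √Real.pi ^ m := by
  rw [← (PiLp.volume_preserving_toLp (Fin (m + 1))).integral_comp
    (MeasurableEquiv.toLp 2 _).measurableEmbedding]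
  have : ∀ x : Fin (m + 1) → ℝ,
      |(WithLp.toLp 2 x : EuclideanSpace ℝ (Fin (m + 1))) 0| * Real.exp (-‖WithLp.toLp 2 x‖ ^ 2) =
      ∏ i, (if i = 0 then |x i| else 1) * Real.exp (-(x i) ^ 2) := by
    intro x
    rw [EuclideanSpace.norm_sq_eq, Finset.prod_mul_distrib, ← Real.exp_sum]
    simp
  simp_rw [this]
  rw [integral_fintype_prod_volume_eq_prod
    (fun i : Fin (m + 1) => fun t : ℝ => (if i = 0 then |t| else 1) * Real.exp (-t ^ 2)),
    Fin.prod_univ_succ]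
  simp [integral_exp_neg_sq, integral_abs_mul_exp_neg_sq]

/-- The Gaussian integral computed both in Cartesian and in polar coordinates. -/
theorem sphereMeasure_real_univ_mul_Gamma (m : ℕ) :
    (sphereMeasure (m + 1)).real univ * (1 / 2 * Real.Gamma (((m : ℝ) + 1) / 2)) =
      √Real.pi ^ (m + 1) := by
  have h := integral_polar m (fun _ => 1) (fun t => Real.exp (-t ^ 2))
  simp only [one_mul] at h
  rw [integral_exp_neg_norm_sq, integral_pow_mul_exp_neg_sq, integral_const] at h
  simpa using h.symm

/-- The same Gaussian computation with the extra factor `|x_0|`. Being homogeneous of degree one, it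
adds one power of the radius, which shifts the Gamma argument by `1/2`. -/
theorem integral_abs_coord_sphereMeasure_mul_Gamma (m : ℕ) :
    (∫ z, |z 0| ∂(sphereMeasure (m + 1))) * (1 / 2 * Real.Gamma (((m : ℝ) + 1) / 2 + 1 / 2)) =
      √Real.pi ^ m := by
  have h := integral_polar m (fun z => |z 0|) (fun t => t * Real.exp (-t ^ 2))
  have h1 : ∀ t : ℝ, t ^ m * (t * Real.exp (-t ^ 2)) = t ^ (m + 1) * Real.exp (-t ^ 2) :=
    fun t => by ring
  simp_rw [h1] at h
  rw [integral_pow_mul_exp_neg_sq] at h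
  rw [← integral_abs_coord_mul_exp_neg_norm_sq, ← add_div]
  push_cast at h
  rw [← h]
  refine integral_congr_ae (.of_forall fun x => ?_)
  rcases eq_or_ne x 0 with rfl | hx
  · simp
  have hx' : 0 < ‖x‖ := norm_pos_iff.mpr hx
  simp only [PiLp.smul_apply, smul_eq_mul, abs_mul, abs_inv, abs_norm]
  field_simp

/-- `E|z_1|` for `z` uniform on the unit sphere. -/
theorem integral_abs_coord_sphereMeasure (m : ℕ) :
    ∫ z, |z 0| ∂(sphereMeasure (m + 1)) = (sphereMeasure (m + 1)).real univ *
      (Real.Gamma (((m : ℝ) + 1) / 2) / (√Real.pi * Real.Gamma (((m : ℝ) + 1) / 2 + 1 / 2))) := by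
  have h1 := sphereMeasure_real_univ_mul_Gamma m
  have h2 := integral_abs_coord_sphereMeasure_mul_Gamma m
  have hm : (0 : ℝ) < ((m : ℝ) + 1) / 2 := by positivity
  have g1 := Real.Gamma_pos_of_pos hm
  have g2 := Real.Gamma_pos_of_pos (add_pos hm (half_pos one_pos))
  have hpi : 0 < √Real.pi := Real.sqrt_pos.mpr Real.pi_pos
  rw [mul_div_assoc', eq_div_iff (by positivity)]
  rw [pow_succ, ← h2] at h1
  linarith

theorem integrable_sphereMeasure {m : ℕ} {f : EuclideanSpace ℝ (Fin m) → ℝ} (hf : Continuous f) :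
    Integrable f (sphereMeasure m) := by
  obtain ⟨C, hC⟩ := (isCompact_sphere (0 : EuclideanSpace ℝ (Fin m)) 1).exists_bound_of_continuousOn
    hf.continuousOn
  refine Integrable.of_bound hf.aestronglyMeasurable C ?_
  filter_upwards [ae_norm_eq_one_sphereMeasure m] with z hz
  exact hC z (by simpa using hz)

/-- The reflection in the hyperplane orthogonal to `u - e` exchanges the unit vectors `u` and `e`
and preserves the surface measure. -/
theorem integral_abs_inner_sphereMeasure {m : ℕ} {u : EuclideanSpace ℝ (Fin (m + 1))}
    (hu : ‖u‖ = 1) :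
    ∫ z, |inner ℝ z u| ∂(sphereMeasure (m + 1)) = ∫ z, |z 0| ∂(sphereMeasure (m + 1)) := by
  set e : EuclideanSpace ℝ (Fin (m + 1)) := EuclideanSpace.single 0 1 with he
  have hr : (ℝ ∙ (u - e))ᗮ.reflection u = e := Submodule.reflection_sub (by simp [he, hu])
  rw [← integral_sphereMeasure_comp (ℝ ∙ (u - e))ᗮ.reflection fun z => |z 0|]
  refine integral_congr_ae (.of_forall fun z => ?_)
  have : inner ℝ ((ℝ ∙ (u - e))ᗮ.reflection z) e = inner ℝ z u := by
    have h := LinearIsometryEquiv.inner_map_map (ℝ ∙ (u - e))ᗮ.reflection z u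
    rwa [hr] at h
  simp only [← this, he, EuclideanSpace.inner_single_right]
  simp

theorem setIntegral_inner_hemisphere {m : ℕ} {u : EuclideanSpace ℝ (Fin (m + 1))}
    (hu : ‖u‖ = 1) :
    ∫ z in {z | 0 < inner ℝ z u}, inner ℝ z u ∂(sphereMeasure (m + 1)) =
      (∫ z, |z 0| ∂(sphereMeasure (m + 1))) / 2 := by
  set s := sphereMeasure (m + 1)
  have hH := measurableSet_hemisphere u
  have hH' := measurableSet_hemisphere (-u)
  have hc : Continuous fun z : EuclideanSpace ℝ (Fin (m + 1)) => inner ℝ z u :=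
    continuous_id.inner continuous_const
  have hneg : ∫ z in {z | 0 < inner ℝ z (-u)}, -inner ℝ z u ∂s =
      ∫ z in {z | 0 < inner ℝ z u}, inner ℝ z u ∂s := by
    rw [← integral_indicator hH, ← integral_indicator hH',
      ← integral_sphereMeasure_comp (LinearIsometryEquiv.neg ℝ)]
    congr 1
    ext z
    simp [indicator]
  have hu0 : u ≠ 0 := by
    rintro rfl
    simp at hu
  have h1 : ∫ z, |inner ℝ z u| ∂s = ∫ z in {z | 0 < inner ℝ z u}, inner ℝ z u ∂s +
      ∫ z in {z | 0 < inner ℝ z (-u)}, -inner ℝ z u ∂s := by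
    have h2 : ∫ z, |inner ℝ z u| ∂s = ∫ z, |inner ℝ z u| ∂(s.restrict {z | 0 < inner ℝ z u} +
        s.restrict {z | 0 < inner ℝ z (-u)}) := by
      rw [sphereMeasure_restrict_add_restrict_neg hu0]
    rw [h2, integral_add_measure (integrable_sphereMeasure hc.abs).integrableOn
      (integrable_sphereMeasure hc.abs).integrableOn]
    congr 1
    · exact setIntegral_congr_fun hH fun z hz => abs_of_pos hz
    · refine setIntegral_congr_fun hH' fun z hz => abs_of_neg ?_
      simpa using hz
  rw [hneg, integral_abs_inner_sphereMeasure hu] at h1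
  linarith

/-- The reflection through the line of `u` preserves the hemisphere, and the mean of `z` and its
reflection is `⟪z, u⟫ u`. So the barycentre of the hemisphere is parallel to `u`. -/
theorem setIntegral_inner_hemisphere_right {m : ℕ} {u : EuclideanSpace ℝ (Fin (m + 1))}
    (hu : ‖u‖ = 1) (w : EuclideanSpace ℝ (Fin (m + 1))) :
    ∫ z in {z | 0 < inner ℝ z u}, inner ℝ z w ∂(sphereMeasure (m + 1)) =
      inner ℝ u w * ((∫ z, |z 0| ∂(sphereMeasure (m + 1))) / 2) := by
  set s := sphereMeasure (m + 1)
  have hH := measurableSet_hemisphere u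
  have hR : ∀ z, (ℝ ∙ u).reflection z = (2 * inner ℝ z u) • u - z := fun z => by
    rw [Submodule.reflection_singleton_apply, hu, real_inner_comm, ← Nat.cast_smul_eq_nsmul ℝ,
      smul_smul]
    simp
  have hint : ∀ v : EuclideanSpace ℝ (Fin (m + 1)),
      IntegrableOn (fun z => inner ℝ z v) {z | 0 < inner ℝ z u} s := fun v =>
    (integrable_sphereMeasure (continuous_id.inner continuous_const)).integrableOn
  have h1 : ∫ z in {z | 0 < inner ℝ z u}, inner ℝ z w ∂s =
      ∫ z in {z | 0 < inner ℝ z u}, (2 * inner ℝ u w * inner ℝ z u - inner ℝ z w) ∂s := by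
    rw [← integral_indicator hH, ← integral_indicator hH,
      ← integral_sphereMeasure_comp (ℝ ∙ u).reflection]
    congr 1
    ext z
    have hzu : inner ℝ ((ℝ ∙ u).reflection z) u = inner ℝ z u := by
      rw [hR, inner_sub_left, real_inner_smul_left, real_inner_self_eq_norm_sq, hu]
      ring
    have hzw : inner ℝ ((ℝ ∙ u).reflection z) w =
        2 * inner ℝ u w * inner ℝ z u - inner ℝ z w := by
      rw [hR, inner_sub_left, real_inner_smul_left]
      ring
    simp only [indicator, mem_ofPred_eq, hzu, hzw]
  rw [integral_sub ((hint u).const_mul _) (hint w), integral_const_mul,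
    setIntegral_inner_hemisphere hu] at h1
  linarith

/-- Swapping coordinates shows that all these integrals agree, and the squares add up to `1` on the
sphere. -/
theorem integral_coord_sq_sphereMeasure {m : ℕ} (i : Fin (m + 1)) :
    ∫ z, z i ^ 2 ∂(sphereMeasure (m + 1)) =
      (sphereMeasure (m + 1)).real univ / ((m : ℝ) + 1) := by
  set s := sphereMeasure (m + 1)
  have hsym : ∀ j, ∫ z, z j ^ 2 ∂s = ∫ z, z i ^ 2 ∂s := fun j => by
    rw [← integral_sphereMeasure_comp
      (LinearIsometryEquiv.piLpCongrLeft 2 ℝ ℝ (Equiv.swap i j)) fun z => z i ^ 2]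
    simp [s, LinearIsometryEquiv.piLpCongrLeft_apply]
  have hsum : ∑ j, ∫ z, z j ^ 2 ∂s = s.real univ := by
    rw [← integral_finsetSum _ fun j _ => integrable_sphereMeasure (by fun_prop)]
    calc ∫ z, ∑ j, z j ^ 2 ∂s = ∫ _, (1 : ℝ) ∂s := by
          refine integral_congr_ae ?_
          filter_upwards [ae_norm_eq_one_sphereMeasure (m + 1)] with z hz
          have := EuclideanSpace.norm_sq_eq z
          simp only [hz, Real.norm_eq_abs, sq_abs] at this
          rw [← this]
          norm_num
      _ = _ := by simp
  simp only [hsym, Finset.sum_const, Finset.card_univ, Fintype.card_fin, nsmul_eq_mul] at hsum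
  rw [eq_div_iff (by positivity), ← hsum]
  push_cast
  ring

end SphereMoments

/-! ## Moments of the sphere channel -/

section ChannelMoments

variable {m : ℕ} {α r : ℝ} {v : EuclideanSpace ℝ (Fin (m + 1))}

theorem sphereMeasure_real_univ_pos (m : ℕ) : 0 < (sphereMeasure (m + 1)).real univ :=
  ENNReal.toReal_pos (sphereMeasure_univ_ne_zero m) (measure_ne_top _ _)

theorem norm_unitDir (v : EuclideanSpace ℝ (Fin (m + 1))) : ‖unitDir v‖ = 1 := by
  unfold unitDir
  split_ifs with h
  · simp
  · simp [norm_smul, h]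

theorem norm_smul_unitDir (v : EuclideanSpace ℝ (Fin (m + 1))) : ‖v‖ • unitDir v = v := by
  unfold unitDir
  split_ifs with h
  · simp [h]
  · rw [smul_smul, mul_inv_cancel₀ (norm_ne_zero_iff.mpr h), one_smul]

theorem toReal_two_mul_inv_sphereMeasure_univ (m : ℕ) :
    (2 * (sphereMeasure (m + 1) univ)⁻¹).toReal = 2 / (sphereMeasure (m + 1)).real univ := by
  rw [ENNReal.toReal_mul, ENNReal.toReal_inv, ← measureReal_def]
  simp [div_eq_mul_inv]

theorem two_mul_inv_sphereMeasure_univ_ne_top (m : ℕ) :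
    2 * (sphereMeasure (m + 1) univ)⁻¹ ≠ ∞ :=
  ENNReal.mul_ne_top (by simp) (ENNReal.inv_ne_top.mpr (sphereMeasure_univ_ne_zero m))

instance (m : ℕ) (B : ℝ) : IsFiniteMeasure (doubledUniform (m + 1) B) :=
  Measure.smul_finite _ (two_mul_inv_sphereMeasure_univ_ne_top m)

theorem integral_uniformHemisphere (B : ℝ) {u : EuclideanSpace ℝ (Fin (m + 1))} (hu : ‖u‖ = 1)
    (i : Fin (m + 1)) :
    ∫ z, z i ∂(uniformHemisphere (m + 1) B u) =
      B * (Real.Gamma (((m : ℝ) + 1) / 2) / (√Real.pi * Real.Gamma (((m : ℝ) + 1) / 2 + 1 / 2)))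
        * u i := by
  have hu0 : u ≠ 0 := by
    rintro rfl
    simp at hu
  have hT := sphereMeasure_real_univ_pos m
  rw [uniformHemisphere_eq B hu0, integral_smul_measure, toReal_two_mul_inv_sphereMeasure_univ,
    integral_map (measurable_const_smul B).aemeasurable
      (by fun_prop : Continuous fun z : EuclideanSpace ℝ (Fin (m + 1)) => z i).aestronglyMeasurable]
  have h := setIntegral_inner_hemisphere_right hu (EuclideanSpace.single i 1)
  rw [integral_abs_coord_sphereMeasure] at h
  simp only [EuclideanSpace.inner_single_right, conj_trivial, one_mul] at h
  simp only [PiLp.smul_apply, smul_eq_mul]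
  rw [integral_const_mul, h]
  field_simp

theorem ae_norm_le_doubledUniform (B : ℝ) : ∀ᵐ z ∂(doubledUniform (m + 1) B), ‖z‖ ≤ |B| := by
  refine Measure.ae_smul_measure ?_ _
  rw [ae_map_iff (measurable_const_smul B).aemeasurable
    (measurableSet_le measurable_norm measurable_const)]
  filter_upwards [ae_norm_eq_one_sphereMeasure (m + 1)] with z hz
  simp [norm_smul, hz]

theorem bernWeight_logistic_le_one (α : ℝ) (b : Bool) :
    bernWeight (Real.exp α / (Real.exp α + 1)) b ≤ 1 := by
  have := sum_bernWeight (p := Real.exp α / (Real.exp α + 1)) (by positivity)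
    (div_le_one_of_le₀ (by linarith) (by positivity))
  rw [← this]
  exact Finset.single_le_sum (f := fun b => bernWeight (Real.exp α / (Real.exp α + 1)) b)
    (fun _ _ => zero_le) (Finset.mem_univ b)

theorem sphereChannelLaw_le_doubledUniform (hα : 0 ≤ α) (hv : v ∈ closedBall 0 r) :
    sphereChannelLaw m α r v ≤ doubledUniform (m + 1) (sphereRadius (m + 1) α r) := by
  refine (sphereChannelLaw_le hα hv).trans (Measure.le_iff'.mpr fun A => ?_)
  rw [Measure.smul_apply, smul_eq_mul]
  exact mul_le_of_le_one_left' (bernWeight_logistic_le_one α true)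

theorem ae_norm_le_sphereChannelLaw (hα : 0 ≤ α) (hv : v ∈ closedBall 0 r) :
    ∀ᵐ z ∂(sphereChannelLaw m α r v), ‖z‖ ≤ |sphereRadius (m + 1) α r| :=
  (Measure.absolutelyContinuous_of_le (sphereChannelLaw_le_doubledUniform hα hv)).ae_le
    (ae_norm_le_doubledUniform _)

theorem memLp_coord_sphereChannelLaw (hα : 0 ≤ α) (hv : v ∈ closedBall 0 r) (i : Fin (m + 1)) :
    MemLp (fun z => z i) 2 (sphereChannelLaw m α r v) := by
  have := isProbabilityMeasure_sphereChannelLaw m α r hv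
  refine MemLp.of_bound
    (by fun_prop : Continuous fun z : EuclideanSpace ℝ (Fin (m + 1)) => z i).aestronglyMeasurable
    |sphereRadius (m + 1) α r| ?_
  filter_upwards [ae_norm_le_sphereChannelLaw hα hv] with z hz
  exact (PiLp.norm_apply_le z i).trans hz

theorem toReal_bernWeight {p : ℝ} (h0 : 0 ≤ p) (h1 : p ≤ 1) (b : Bool) :
    (bernWeight p b).toReal = if b then p else 1 - p := by
  rw [bernWeight, ENNReal.toReal_ofReal]
  split_ifs <;> linarith

/-- The left-hand side is the length of the mean of a hemisphere of the output radius. It must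
exceed `r` by the inverse of `2P(K=1) - 1 = (e^α - 1)/(e^α + 1)` to undo the shrinkage caused by
`K`. -/
theorem sphereRadius_mul_eq (hα : 0 < α) :
    sphereRadius (m + 1) α r *
      (Real.Gamma (((m : ℝ) + 1) / 2) / (√Real.pi * Real.Gamma (((m : ℝ) + 1) / 2 + 1 / 2))) =
      r * ((Real.exp α + 1) / (Real.exp α - 1)) := by
  have hm : (0 : ℝ) < ((m : ℝ) + 1) / 2 := by positivity
  have g1 := Real.Gamma_pos_of_pos hm
  have g2 := Real.Gamma_pos_of_pos (add_pos hm (half_pos one_pos))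
  have hpi : 0 < √Real.pi := Real.sqrt_pos.mpr Real.pi_pos
  have h1 : 0 < Real.exp α - 1 := by linarith [Real.add_one_lt_exp hα.ne']
  rw [sphereRadius]
  push_cast
  rw [Real.Gamma_add_one hm.ne', add_div ((m : ℝ) + 1)]
  field_simp

/-- The sphere channel is unbiased. -/
theorem integral_coord_sphereChannelLaw (hα : 0 < α) (hr : 0 < r) (hv : v ∈ closedBall 0 r)
    (i : Fin (m + 1)) : ∫ z, z i ∂(sphereChannelLaw m α r v) = v i := by
  have hv' : ‖v‖ ≤ r := by simpa using hv
  have hS0 : 0 ≤ 1 / 2 + ‖v‖ / (2 * r) := by positivity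
  have hS1 : 1 / 2 + ‖v‖ / (2 * r) ≤ 1 := by
    have : ‖v‖ / (2 * r) ≤ 1 / 2 := by
      rw [div_le_div_iff₀ (by positivity) two_pos]
      linarith
    linarith
  have hK0 : 0 ≤ Real.exp α / (Real.exp α + 1) := by positivity
  have hK1 : Real.exp α / (Real.exp α + 1) ≤ 1 :=
    div_le_one_of_le₀ (by linarith) (by positivity)
  have hu := norm_unitDir v
  have hprob : ∀ u : EuclideanSpace ℝ (Fin (m + 1)), ‖u‖ = 1 →
      Integrable (fun z => z i)
        (uniformHemisphere (m + 1) (sphereRadius (m + 1) α r) u) := fun u hu => by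
    have hu0 : u ≠ 0 := by
      rintro rfl
      simp at hu
    have := isProbabilityMeasure_uniformHemisphere m (sphereRadius (m + 1) α r) hu0
    refine Integrable.of_bound (by fun_prop : Continuous
        fun z : EuclideanSpace ℝ (Fin (m + 1)) => z i).aestronglyMeasurable
      |sphereRadius (m + 1) α r| ?_
    have hle : uniformHemisphere (m + 1) (sphereRadius (m + 1) α r) u ≤
        doubledUniform (m + 1) (sphereRadius (m + 1) α r) := by
      rw [← uniformHemisphere_add_neg _ hu0]
      exact Measure.le_add_right le_rfl
    filter_upwards [(Measure.absolutelyContinuous_of_le hle).ae_le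
      (ae_norm_le_doubledUniform _)] with z hz
    exact (PiLp.norm_apply_le z i).trans hz
  have hbtop : ∀ (p : ℝ) (b : Bool), bernWeight p b ≠ ∞ := fun p b => ENNReal.ofReal_ne_top
  rw [sphereChannelLaw_eq, integral_add_measure, integral_smul_measure, integral_smul_measure,
    integral_uniformHemisphere _ hu, integral_uniformHemisphere _ (by rwa [norm_neg]),
    ENNReal.toReal_add, ENNReal.toReal_add, sphereRadius_mul_eq hα]
  -- The two hemisphere means are opposite, so only the difference of their weights counts. It
  -- equals `(2P(K=1) - 1)(2P(S=1) - 1)`, that is `(e^α - 1)/(e^α + 1)` times `‖v‖/r`.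
  · simp only [ENNReal.toReal_mul, toReal_bernWeight hS0 hS1, toReal_bernWeight hK0 hK1, if_true,
      Bool.false_eq_true, if_false, smul_eq_mul, PiLp.neg_apply]
    have h1 : 0 < Real.exp α - 1 := by linarith [Real.add_one_lt_exp hα.ne']
    have hvi : v i = ‖v‖ * unitDir v i := by
      nth_rewrite 1 [← norm_smul_unitDir v]
      simp
    rw [hvi]
    field_simp
    ring
  all_goals first
    | exact ENNReal.mul_ne_top (hbtop _ _) (hbtop _ _)
    | refine (hprob _ ?_).smul_measure (ENNReal.add_ne_top.mpr
        ⟨ENNReal.mul_ne_top (hbtop _ _) (hbtop _ _), ENNReal.mul_ne_top (hbtop _ _) (hbtop _ _)⟩)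
      simp [hu]

/-- Domination by twice the uniform law on the whole sphere spreads the second moment evenly over
the coordinates, at the cost of a factor `2`. -/
theorem integral_coord_sq_sphereChannelLaw_le (hα : 0 ≤ α) (hv : v ∈ closedBall 0 r)
    (i : Fin (m + 1)) :
    ∫ z, z i ^ 2 ∂(sphereChannelLaw m α r v) ≤
      2 * sphereRadius (m + 1) α r ^ 2 / ((m : ℝ) + 1) := by
  have hc : Continuous fun z : EuclideanSpace ℝ (Fin (m + 1)) => z i ^ 2 := by fun_prop
  have hT := sphereMeasure_real_univ_pos m
  calc _ ≤ ∫ z, z i ^ 2 ∂(doubledUniform (m + 1) (sphereRadius (m + 1) α r)) := by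
        refine integral_mono_measure (sphereChannelLaw_le_doubledUniform hα hv)
          (.of_forall fun z => sq_nonneg _) ?_
        refine Integrable.of_bound hc.aestronglyMeasurable (|sphereRadius (m + 1) α r| ^ 2) ?_
        filter_upwards [ae_norm_le_doubledUniform _] with z hz
        rw [norm_pow]
        exact pow_le_pow_left₀ (norm_nonneg _) ((PiLp.norm_apply_le z i).trans hz) 2
    _ = _ := by
        rw [doubledUniform, integral_smul_measure, toReal_two_mul_inv_sphereMeasure_univ,
          integral_map (measurable_const_smul _).aemeasurable hc.aestronglyMeasurable]
        simp only [PiLp.smul_apply, smul_eq_mul, mul_pow]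
        rw [integral_const_mul, integral_coord_sq_sphereMeasure]
        field_simp

/-- Log-convexity of Gamma at the midpoint of `x` and `x + 1`, with `x = (m+1)/2`, gives `Γ(x+1/2)²
≤ Γ(x) Γ(x+1) = Γ(x+1)²/x`. -/
theorem Gamma_ratio_sq_le (m : ℕ) :
    (Real.Gamma (((m : ℝ) + 1 + 1) / 2) / Real.Gamma (((m : ℝ) + 1) / 2 + 1)) ^ 2 ≤
      2 / ((m : ℝ) + 1) := by
  have hm : (0 : ℝ) < ((m : ℝ) + 1) / 2 := by positivity
  have g0 := Real.Gamma_pos_of_pos hm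
  have g1 := Real.Gamma_pos_of_pos (add_pos hm one_pos)
  have g2 : 0 < Real.Gamma (((m : ℝ) + 1 + 1) / 2) := Real.Gamma_pos_of_pos (by positivity)
  have h := Real.Gamma_mul_add_mul_le_rpow_Gamma_mul_rpow_Gamma hm (add_pos hm one_pos)
    (half_pos one_pos) (half_pos one_pos) (by norm_num)
  rw [show 1 / 2 * (((m : ℝ) + 1) / 2) + 1 / 2 * (((m : ℝ) + 1) / 2 + 1) =
    ((m : ℝ) + 1 + 1) / 2 by ring, ← Real.sqrt_eq_rpow, ← Real.sqrt_eq_rpow,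
    ← Real.sqrt_mul g0.le] at h
  have h2 : Real.Gamma (((m : ℝ) + 1 + 1) / 2) ^ 2 ≤
      Real.Gamma (((m : ℝ) + 1) / 2) * Real.Gamma (((m : ℝ) + 1) / 2 + 1) := by
    rw [← Real.sq_sqrt (mul_nonneg g0.le g1.le)]
    exact pow_le_pow_left₀ g2.le h 2
  rw [div_pow, div_le_iff₀ (by positivity)]
  refine h2.trans (le_of_eq ?_)
  rw [Real.Gamma_add_one hm.ne']
  field_simp

/-- In dimension `m + 1`, at radius `√(m + 1)`, every coordinate of the output has second moment
of order `(m + 1) / α²`. -/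
theorem integral_coord_sq_sphereChannelLaw_le_of_le {Λ : ℝ} (hα : 0 < α) (hΛ : α ≤ Λ)
    (hv : v ∈ closedBall 0 √((m + 1 : ℕ) : ℝ)) (i : Fin (m + 1)) :
    ∫ z, z i ^ 2 ∂(sphereChannelLaw m α √((m + 1 : ℕ) : ℝ) v) ≤
      Real.pi * (Real.exp Λ + 1) ^ 2 * (((m : ℝ) + 1) / α ^ 2) := by
  refine (integral_coord_sq_sphereChannelLaw_le hα.le hv i).trans ?_
  have hG := Gamma_ratio_sq_le m
  -- This is the source of the rate `1/α²`; the numerator `e^α + 1` is the only place where the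
  -- upper bound `Λ` is needed.
  have h1 : α ≤ Real.exp α - 1 := by linarith [Real.add_one_le_exp α]
  have hratio : ((Real.exp α + 1) / (Real.exp α - 1)) ^ 2 ≤ (Real.exp Λ + 1) ^ 2 / α ^ 2 := by
    rw [← div_pow]
    gcongr
    · exact div_nonneg (by positivity) (by linarith)
  have hm : (0 : ℝ) < (m : ℝ) + 1 := by positivity
  rw [sphereRadius]
  push_cast
  simp only [mul_pow, div_pow √Real.pi]
  rw [Real.sq_sqrt Real.pi_pos.le, Real.sq_sqrt hm.le]
  calc 2 * (Real.pi / 2 ^ 2 * ((m : ℝ) + 1) ^ 2 * ((m : ℝ) + 1) *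
        ((Real.exp α + 1) / (Real.exp α - 1)) ^ 2 *
        (Real.Gamma (((m : ℝ) + 1 + 1) / 2) / Real.Gamma (((m : ℝ) + 1) / 2 + 1)) ^ 2) /
          ((m : ℝ) + 1)
      ≤ 2 * (Real.pi / 2 ^ 2 * ((m : ℝ) + 1) ^ 2 * ((m : ℝ) + 1) *
        ((Real.exp Λ + 1) ^ 2 / α ^ 2) * (2 / ((m : ℝ) + 1))) / ((m : ℝ) + 1) := by
        have := Real.pi_pos
        gcongr
    _ = _ := by
        field_simp

end ChannelMoments

/-! ## Moments of the mean-estimation mechanism -/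

section MeanMoments

variable {p : ℕ} {c : Fin (p + 1) → ℝ} {Λ : ℝ}

theorem weight_nonneg (c : Fin (p + 1) → ℝ) (k : Fin (p + 1)) : 0 ≤ weight c k := by
  unfold weight
  positivity

/-- The contribution of the `k`-th channel to the `i`-th coordinate of the estimate. -/
noncomputable def aggregateTerm (c : Fin (p + 1) → ℝ) (i k : Fin (p + 1))
    (y : EuclideanSpace ℝ (Fin (p - (k : ℕ) + 1))) : ℝ :=
  (if k ≤ i then weight c k / ∑ k ∈ Finset.Iic i, weight c k else 0) *
    y ⟨(i : ℕ) - (k : ℕ), by omega⟩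

theorem aggregate_apply (c : Fin (p + 1) → ℝ)
    (Y : ∀ k : Fin (p + 1), EuclideanSpace ℝ (Fin (p - (k : ℕ) + 1))) (i : Fin (p + 1)) :
    aggregate c Y i = ∑ k, aggregateTerm c i k (Y k) := by
  have : ∀ k, aggregateTerm c i k (Y k) = if k ∈ Finset.Iic i then
      Y k ⟨(i : ℕ) - (k : ℕ), by omega⟩ * weight c k / ∑ k ∈ Finset.Iic i, weight c k else 0 := by
    intro k
    simp only [aggregateTerm, Finset.mem_Iic]
    split_ifs <;> ring
  simp_rw [this]
  rw [Finset.sum_ite_mem, Finset.univ_inter, ← Finset.sum_div]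
  rfl

theorem memLp_aggregateTerm (hc : ∀ k, 0 ≤ increment c k) (i k : Fin (p + 1)) (x : DataCube p) :
    MemLp (aggregateTerm c i k) 2 (tailChannel sphereChannel c k x) :=
  (memLp_coord_sphereChannelLaw (hc k) (tailVec_mem k x) _).const_mul _

theorem integral_aggregateTerm (hc : ∀ k, 0 ≤ increment c k) (i k : Fin (p + 1))
    (x : DataCube p) :
    ∫ y, aggregateTerm c i k y ∂(tailChannel sphereChannel c k x) =
      (if k ≤ i then weight c k / ∑ k ∈ Finset.Iic i, weight c k else 0) * x i := by
  unfold aggregateTerm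
  rw [integral_const_mul]
  split_ifs with hk
  -- A channel at level zero is not unbiased, but its weight vanishes, so it does not contribute.
  · rcases (hc k).eq_or_lt with h0 | h0
    · simp [weight, ← h0]
    · congr 1
      refine (integral_coord_sphereChannelLaw h0 (Real.sqrt_pos.mpr (by positivity))
        (tailVec_mem k x) _).trans ?_
      have : k.val + (i.val - k.val) = i.val := Nat.add_sub_cancel' hk
      simp [tailVec, this]
  · simp

/-- The second moment of a coordinate of the `k`-th channel is at most a constant times `1/w_k`;
this cancels one of the two factors `w_k` in the squared coefficient. -/
theorem integral_sq_aggregateTerm_le (hc : ∀ k, 0 ≤ increment c k)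
    (hΛ : ∀ k, increment c k ≤ Λ) (i k : Fin (p + 1)) (x : DataCube p) :
    ∫ y, aggregateTerm c i k y ^ 2 ∂(tailChannel sphereChannel c k x) ≤
      Real.pi * (Real.exp Λ + 1) ^ 2 *
        if k ∈ Finset.Iic i then weight c k / (∑ k ∈ Finset.Iic i, weight c k) ^ 2 else 0 := by
  simp only [aggregateTerm, mul_pow, Finset.mem_Iic]
  rw [integral_const_mul]
  split_ifs with hk
  · rcases (hc k).eq_or_lt with h0 | h0
    · simp [weight, ← h0]
    · have h := integral_coord_sq_sphereChannelLaw_le_of_le h0 (hΛ k) (tailVec_mem k x)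
        ⟨(i : ℕ) - (k : ℕ), by omega⟩
      refine (mul_le_mul_of_nonneg_left h (sq_nonneg _)).trans (le_of_eq ?_)
      have hw : weight c k * ((((p - (k : ℕ) : ℕ) : ℝ) + 1) / increment c k ^ 2) = 1 := by
        rw [weight]
        push_cast
        field_simp
      rw [div_pow]
      linear_combination (Real.pi * (Real.exp Λ + 1) ^ 2 * weight c k /
        (∑ k ∈ Finset.Iic i, weight c k) ^ 2) * hw
  · simp

theorem meanMechanism_apply (M : ChannelFamily) (c : Fin (p + 1) → ℝ) (x : DataCube p) :
    meanMechanism M c x =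
      (Measure.pi fun k => tailChannel M c k x).map (aggregate c) :=
  Kernel.map_apply _ (measurable_aggregate c) x

theorem memLp_coord_meanMechanism (hc : ∀ k, 0 ≤ increment c k) (i : Fin (p + 1))
    (x : DataCube p) : MemLp (fun y => y i) 2 (meanMechanism sphereChannel c x) := by
  rw [meanMechanism_apply, memLp_map_measure_iff
    (by fun_prop : Continuous fun z : EuclideanSpace ℝ (Fin (p + 1)) => z i).aestronglyMeasurable
    (measurable_aggregate c).aemeasurable]
  simp only [Function.comp_def, aggregate_apply]
  exact memLp_finsetSum _ fun k _ => (memLp_aggregateTerm hc i k x).comp_measurePreserving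
    (measurePreserving_eval (fun k => tailChannel sphereChannel c k x) k)

/-- The mean-estimation mechanism is unbiased wherever some weight is positive. -/
theorem integral_coord_meanMechanism (hc : ∀ k, 0 ≤ increment c k) {i : Fin (p + 1)}
    (hW : 0 < ∑ k ∈ Finset.Iic i, weight c k) (x : DataCube p) :
    ∫ y, y i ∂(meanMechanism sphereChannel c x) = x i := by
  rw [meanMechanism_apply, integral_map (measurable_aggregate c).aemeasurable
    (by fun_prop : Continuous fun z : EuclideanSpace ℝ (Fin (p + 1)) => z i).aestronglyMeasurable]
  simp only [aggregate_apply]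
  rw [integral_finsetSum _ fun k _ =>
    integrable_comp_eval ((memLp_aggregateTerm hc i k x).integrable one_le_two)]
  have : ∀ k, ∫ Y, aggregateTerm c i k (Y k)
      ∂(Measure.pi fun k => tailChannel sphereChannel c k x) =
      (if k ∈ Finset.Iic i then weight c k / ∑ k ∈ Finset.Iic i, weight c k else 0) * x i := by
    intro k
    rw [integral_comp_eval (μ := fun k => tailChannel sphereChannel c k x)
      (memLp_aggregateTerm hc i k x).aestronglyMeasurable, integral_aggregateTerm hc]
    simp
  simp_rw [this]
  rw [← Finset.sum_mul, Finset.sum_ite_mem, Finset.univ_inter, ← Finset.sum_div, div_self hW.ne',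
    one_mul]

/-- The terms are independent given the data, so their variances add, and with `W` the sum of the
weights, `∑ w_k/W² = 1/W`. -/
theorem variance_coord_meanMechanism_le (hc : ∀ k, 0 ≤ increment c k)
    (hΛ : ∀ k, increment c k ≤ Λ) {i : Fin (p + 1)}
    (hW : 0 < ∑ k ∈ Finset.Iic i, weight c k) (x : DataCube p) :
    Var[fun y => y i; meanMechanism sphereChannel c x] ≤
      Real.pi * (Real.exp Λ + 1) ^ 2 * (∑ k ∈ Finset.Iic i, weight c k)⁻¹ := by
  rw [meanMechanism_apply, variance_map
    (by fun_prop : Continuous fun z : EuclideanSpace ℝ (Fin (p + 1)) => z i).aemeasurable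
    (measurable_aggregate c).aemeasurable]
  have : (fun y : EuclideanSpace ℝ (Fin (p + 1)) => y i) ∘ aggregate c =
      ∑ k, fun Y => aggregateTerm c i k (Y k) := by
    ext Y
    simp [aggregate_apply]
  rw [this, variance_sum_pi (μ := fun k => tailChannel sphereChannel c k x)
    fun k => memLp_aggregateTerm hc i k x]
  calc _ ≤ ∑ k, Real.pi * (Real.exp Λ + 1) ^ 2 *
        if k ∈ Finset.Iic i then weight c k / (∑ k ∈ Finset.Iic i, weight c k) ^ 2 else 0 :=
        Finset.sum_le_sum fun k _ => (variance_le_expectation_sq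
          (memLp_aggregateTerm hc i k x).aestronglyMeasurable).trans
          (integral_sq_aggregateTerm_le hc hΛ i k x)
    _ = _ := by
        rw [← Finset.mul_sum, Finset.sum_ite_mem, Finset.univ_inter, ← Finset.sum_div]
        field_simp

end MeanMoments

/-! ## The surrogate as a perturbation of the empirical risk -/

section Deterministic

variable {n p : ℕ}

/-- The error `(1/n) ∑_j (x̂^{(j,1)}_a x̂^{(j,2)}_b - x^{(j)}_a x^{(j)}_b)` of the estimated second
moment matrix. -/
noncomputable def reportError (x : Fin n → DataCube p) (a b : Fin (p + 1)) (T : Reports n p) : ℝ :=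
  (1 / (n : ℝ)) * ∑ j, ((T j).1 a * (T j).2 b - (x j a : ℝ) * (x j b : ℝ))

/-- The Frobenius norm of the error matrix. -/
noncomputable def reportErrorNorm (x : Fin n → DataCube p) (T : Reports n p) : ℝ :=
  √(∑ ab : Fin (p + 1) × Fin (p + 1), reportError x ab.1 ab.2 T ^ 2)

theorem featureDot_mul_featureDot (θ : EuclideanSpace ℝ (Fin p)) (y z : Fin (p + 1) → ℝ) :
    featureDot θ y * featureDot θ z =
      ∑ ab : Fin p × Fin p, θ ab.1 * θ ab.2 * (y ab.1.castSucc * z ab.2.castSucc) := by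
  rw [featureDot, featureDot, Finset.sum_mul_sum, Fintype.sum_prod_type]
  exact Finset.sum_congr rfl fun a _ => Finset.sum_congr rfl fun b _ => by ring

/-- The surrogate estimates the quadratic and the cross term of the risk only. The term `l²/2` is
free of `θ`, so its omission does not affect differences of the risk. -/
theorem surrogate_sub_empRisk (x : Fin n → DataCube p) (T : Reports n p)
    (θ : EuclideanSpace ℝ (Fin p)) :
    surrogate T θ - empRisk x θ + (1 / (n : ℝ)) * ∑ j, (1 / 2) * (x j (Fin.last p) : ℝ) ^ 2 =
      (1 / 2) * ∑ ab : Fin p × Fin p,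
          θ ab.1 * θ ab.2 * reportError x ab.1.castSucc ab.2.castSucc T
        - ∑ b, θ b * reportError x (Fin.last p) b.castSucc T := by
  have h1 : ∑ ab : Fin p × Fin p, θ ab.1 * θ ab.2 * reportError x ab.1.castSucc ab.2.castSucc T =
      (1 / (n : ℝ)) * ∑ j, (featureDot θ (T j).1 * featureDot θ (T j).2 -
        featureDot θ (fun i => (x j i : ℝ)) ^ 2) := by
    simp only [sq, featureDot_mul_featureDot, reportError, ← Finset.sum_sub_distrib,
      Finset.mul_sum]
    rw [Finset.sum_comm]
    refine Finset.sum_congr rfl fun j _ => Finset.sum_congr rfl fun ab _ => ?_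
    ring
  have h2 : ∑ b, θ b * reportError x (Fin.last p) b.castSucc T =
      (1 / (n : ℝ)) * ∑ j, ((T j).1 (Fin.last p) * featureDot θ (T j).2 -
        (x j (Fin.last p) : ℝ) * featureDot θ (fun i => (x j i : ℝ))) := by
    simp only [reportError, featureDot, ← Finset.sum_sub_distrib, Finset.mul_sum]
    rw [Finset.sum_comm]
    refine Finset.sum_congr rfl fun j _ => Finset.sum_congr rfl fun b _ => ?_
    ring
  rw [h1, h2, surrogate, empRisk, one_div (2 * (n : ℝ)), mul_inv]
  simp only [Finset.mul_sum, ← Finset.sum_sub_distrib, ← Finset.sum_add_distrib]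
  refine Finset.sum_congr rfl fun j _ => ?_
  ring

/-- Cauchy-Schwarz for each form: the coefficients `θ_a θ_b` have Frobenius norm `‖θ‖²`, and the
feature block and the label row are parts of the full error matrix. -/
theorem abs_surrogate_sub_empRisk_le (x : Fin n → DataCube p) (T : Reports n p)
    (θ : EuclideanSpace ℝ (Fin p)) :
    |surrogate T θ - empRisk x θ + (1 / (n : ℝ)) * ∑ j, (1 / 2) * (x j (Fin.last p) : ℝ) ^ 2| ≤
      (‖θ‖ ^ 2 + ‖θ‖) * reportErrorNorm x T := by
  have hF0 : 0 ≤ reportErrorNorm x T := Real.sqrt_nonneg _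
  have hnonneg : 0 ≤ ∑ ab : Fin (p + 1) × Fin (p + 1), reportError x ab.1 ab.2 T ^ 2 :=
    Finset.sum_nonneg fun _ _ => sq_nonneg _
  have hF : reportErrorNorm x T ^ 2 = _ := Real.sq_sqrt hnonneg
  have hθ : ∑ a, θ a ^ 2 = ‖θ‖ ^ 2 := by simp [EuclideanSpace.norm_sq_eq]
  have hquad : |∑ ab : Fin p × Fin p,
      θ ab.1 * θ ab.2 * reportError x ab.1.castSucc ab.2.castSucc T| ≤
      ‖θ‖ ^ 2 * reportErrorNorm x T := by
    refine abs_le_of_sq_le_sq ?_ (by positivity)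
    refine (Finset.sum_mul_sq_le_sq_mul_sq _ _ _).trans ?_
    rw [mul_pow, hF]
    gcongr
    · refine le_of_eq ?_
      rw [← hθ, sq (∑ a, θ a ^ 2), Finset.sum_mul_sum, Fintype.sum_prod_type]
      simp [mul_pow]
    · exact le_of_eq_of_le (Finset.sum_map Finset.univ
        ((Fin.castSuccEmb (n := p)).prodMap (Fin.castSuccEmb (n := p)))
        fun ab : Fin (p + 1) × Fin (p + 1) => reportError x ab.1 ab.2 T ^ 2).symm
        (Finset.sum_le_univ_sum_of_nonneg fun _ => sq_nonneg _)
  have hlin : |∑ b, θ b * reportError x (Fin.last p) b.castSucc T| ≤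
      ‖θ‖ * reportErrorNorm x T := by
    refine abs_le_of_sq_le_sq ?_ (by positivity)
    refine (Finset.sum_mul_sq_le_sq_mul_sq _ _ _).trans ?_
    rw [mul_pow, hF, hθ]
    gcongr
    exact le_of_eq_of_le (Finset.sum_map Finset.univ
      ((Fin.castSuccEmb (n := p)).trans ⟨fun b => (Fin.last p, b),
        fun _ _ h => (Prod.mk.inj h).2⟩)
      fun ab : Fin (p + 1) × Fin (p + 1) => reportError x ab.1 ab.2 T ^ 2).symm
      (Finset.sum_le_univ_sum_of_nonneg fun _ => sq_nonneg _)
  rw [surrogate_sub_empRisk]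
  have h0 : 0 ≤ ‖θ‖ ^ 2 * reportErrorNorm x T := by positivity
  rw [abs_le] at hquad hlin ⊢
  constructor <;> linarith [hquad.1, hquad.2, hlin.1, hlin.2]

/-- The report vector `0` need not be a possible outcome. It serves as a deterministic test point in
`empRisk_sub_le_dim`, where the surrogate vanishes identically. -/
theorem reportErrorNorm_zero_le (hn : 0 < n) (x : Fin n → DataCube p) :
    reportErrorNorm x 0 ≤ (p : ℝ) + 1 := by
  have hx : ∀ j i, |(x j i : ℝ)| ≤ 1 := fun j i => abs_le.mpr (x j i).2
  have hE : ∀ a b, reportError x a b 0 ^ 2 ≤ 1 := fun a b => by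
    rw [sq_le_one_iff_abs_le_one, reportError, abs_mul, abs_of_nonneg (by positivity)]
    calc 1 / (n : ℝ) * |_| ≤ 1 / (n : ℝ) * ∑ _j : Fin n, 1 := by
          gcongr
          refine (Finset.abs_sum_le_sum_abs _ _).trans (Finset.sum_le_sum fun j _ => ?_)
          simp only [Pi.zero_apply, Prod.fst_zero, Prod.snd_zero, PiLp.zero_apply, mul_zero,
            zero_sub, abs_neg, abs_mul]
          exact mul_le_one₀ (hx j a) (abs_nonneg _) (hx j b)
      _ = 1 := by
          have : (n : ℝ) ≠ 0 := by positivity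
          simp [this]
  rw [reportErrorNorm, Real.sqrt_le_left (by positivity)]
  calc _ ≤ ∑ _ab : Fin (p + 1) × Fin (p + 1), (1 : ℝ) :=
        Finset.sum_le_sum fun ab _ => hE ab.1 ab.2
    _ = _ := by
        simp
        ring

theorem continuous_empRisk (x : Fin n → DataCube p) : Continuous (empRisk x) := by
  unfold empRisk featureDot
  fun_prop

variable {Θ : Set (EuclideanSpace ℝ (Fin p))}

theorem le_maxNormTerm (hΘ : IsCompact Θ) {θ : EuclideanSpace ℝ (Fin p)} (hθ : θ ∈ Θ) :
    ‖θ‖ ^ 2 + ‖θ‖ ≤ maxNormTerm Θ :=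
  le_csSup (hΘ.bddAbove_image (by fun_prop)) ⟨θ, hθ, rfl⟩

theorem maxNormTerm_nonneg (hΘ : IsCompact Θ) (hne : Θ.Nonempty) : 0 ≤ maxNormTerm Θ := by
  obtain ⟨θ, hθ⟩ := hne
  exact le_trans (by positivity) (le_maxNormTerm hΘ hθ)

theorem empRisk_sub_le (hΘ : IsCompact Θ) (x : Fin n → DataCube p) (T : Reports n p)
    {θ θ' : EuclideanSpace ℝ (Fin p)} (hθ : θ ∈ Θ) (hθ' : θ' ∈ Θ) :
    empRisk x θ - empRisk x θ' ≤
      surrogate T θ - surrogate T θ' + 2 * (maxNormTerm Θ * reportErrorNorm x T) := by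
  have hF0 : 0 ≤ reportErrorNorm x T := Real.sqrt_nonneg _
  have h1 := (abs_surrogate_sub_empRisk_le x T θ).trans
    (mul_le_mul_of_nonneg_right (le_maxNormTerm hΘ hθ) hF0)
  have h2 := (abs_surrogate_sub_empRisk_le x T θ').trans
    (mul_le_mul_of_nonneg_right (le_maxNormTerm hΘ hθ') hF0)
  rw [abs_le] at h1 h2
  linarith [h1.1, h2.2]

theorem empRisk_sub_le_dim (hn : 0 < n) (hΘ : IsCompact Θ) (x : Fin n → DataCube p)
    {θ θ' : EuclideanSpace ℝ (Fin p)} (hθ : θ ∈ Θ) (hθ' : θ' ∈ Θ) :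
    empRisk x θ - empRisk x θ' ≤ 2 * (maxNormTerm Θ * ((p : ℝ) + 1)) := by
  have h := empRisk_sub_le hΘ x 0 hθ hθ'
  have hz : ∀ θ : EuclideanSpace ℝ (Fin p), surrogate (0 : Reports n p) θ = 0 := fun θ => by
    simp [surrogate, featureDot]
  rw [hz, hz] at h
  have := mul_le_mul_of_nonneg_left (reportErrorNorm_zero_le hn x)
    (maxNormTerm_nonneg hΘ ⟨θ, hθ⟩)
  linarith

end Deterministic

/-! ## The mean error of the reports -/

section Stochastic

theorem MeasureTheory.MemLp.mul_prod_two {X Y : Type*} [MeasurableSpace X] [MeasurableSpace Y]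
    {μ : Measure X} {ν : Measure Y} [SFinite μ] [SFinite ν] {f : X → ℝ} {g : Y → ℝ}
    (hf : MemLp f 2 μ) (hg : MemLp g 2 ν) : MemLp (fun z => f z.1 * g z.2) 2 (μ.prod ν) := by
  rw [memLp_two_iff_integrable_sq
    (by exact hf.aestronglyMeasurable.comp_fst.mul hg.aestronglyMeasurable.comp_snd)]
  simp only [mul_pow]
  exact hf.integrable_sq.mul_prod hg.integrable_sq

theorem variance_mul_prod {X Y : Type*} [MeasurableSpace X] [MeasurableSpace Y]
    {μ : Measure X} {ν : Measure Y} [IsProbabilityMeasure μ] [IsProbabilityMeasure ν]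
    {f : X → ℝ} {g : Y → ℝ} (hf : MemLp f 2 μ) (hg : MemLp g 2 ν) :
    Var[fun z => f z.1 * g z.2; μ.prod ν] = Var[f; μ] * Var[g; ν] +
      Var[f; μ] * (∫ y, g y ∂ν) ^ 2 + (∫ x, f x ∂μ) ^ 2 * Var[g; ν] := by
  rw [variance_eq_sub (hf.mul_prod_two hg), variance_eq_sub hf, variance_eq_sub hg]
  simp only [Pi.pow_apply, mul_pow]
  rw [integral_prod_mul, integral_prod_mul (fun x => f x ^ 2) (fun y => g y ^ 2)]
  ring

variable {n p : ℕ} {c : Fin (p + 1) → ℝ} {s : Fin (p + 1) → ℝ}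

/-- If the mean-estimation mechanism at `c/2` is unbiased with variances at most `s`, the mean
square error of the estimated second moments is controlled by `s`. -/
theorem integral_reportError_sq_le (x : Fin n → DataCube p)
    (hL : ∀ j i, MemLp (fun y => y i) 2 (meanMechanism sphereChannel (fun i => c i / 2) (x j)))
    (hmean : ∀ j i, ∫ y, y i ∂(meanMechanism sphereChannel (fun i => c i / 2) (x j)) = x j i)
    (hvar : ∀ j i, Var[fun y => y i; meanMechanism sphereChannel (fun i => c i / 2) (x j)] ≤ s i)
    (a b : Fin (p + 1)) :
    Integrable (fun T => reportError x a b T ^ 2) (allReports sphereChannel n c x) ∧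
    ∫ T, reportError x a b T ^ 2 ∂(allReports sphereChannel n c x) ≤
      (1 / (n : ℝ)) * (s a * s b + s a + s b) := by
  set μ : Fin n → Measure (EuclideanSpace ℝ (Fin (p + 1))) :=
    fun j => meanMechanism sphereChannel (fun i => c i / 2) (x j) with hμ
  have hall : allReports sphereChannel n c x = Measure.pi fun j => (μ j).prod (μ j) := by
    change Measure.pi _ = _
    congr 1
    ext1 j
    rw [Kernel.comap_apply, userReport, Kernel.prod_apply]
  set X : ∀ _ : Fin n, EuclideanSpace ℝ (Fin (p + 1)) × EuclideanSpace ℝ (Fin (p + 1)) → ℝ :=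
    fun _ z => (1 / (n : ℝ)) * (z.1 a * z.2 b) with hX
  have hXL0 : ∀ j, MemLp (fun z : EuclideanSpace ℝ (Fin (p + 1)) × EuclideanSpace ℝ (Fin (p + 1))
      => z.1 a * z.2 b) 2 ((μ j).prod (μ j)) := fun j => (hL j a).mul_prod_two (hL j b)
  have hXL : ∀ j, MemLp (X j) 2 ((μ j).prod (μ j)) := fun j => (hXL0 j).const_mul _
  have hsumL : MemLp (∑ j, fun T : Reports n p => X j (T j)) 2
      (Measure.pi fun j => (μ j).prod (μ j)) :=
    memLp_finsetSum' _ fun j _ => (hXL j).comp_measurePreserving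
      (measurePreserving_eval (fun j => (μ j).prod (μ j)) j)
  have hint : ∫ T, (∑ j, fun T : Reports n p => X j (T j)) T
      ∂(Measure.pi fun j => (μ j).prod (μ j)) =
      (1 / (n : ℝ)) * ∑ j, (x j a : ℝ) * (x j b : ℝ) := by
    simp only [Finset.sum_apply]
    rw [integral_finsetSum _ fun j _ => integrable_comp_eval (μ := fun j => (μ j).prod (μ j))
      ((hXL j).integrable one_le_two), Finset.mul_sum]
    refine Finset.sum_congr rfl fun j _ => ?_
    rw [integral_comp_eval (μ := fun j => (μ j).prod (μ j)) (hXL j).aestronglyMeasurable]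
    simp only [hX]
    rw [integral_const_mul, integral_prod_mul (fun y : EuclideanSpace ℝ (Fin (p + 1)) => y a)
      (fun y : EuclideanSpace ℝ (Fin (p + 1)) => y b), hmean, hmean]
  -- Unbiasedness and independence of the two runs make the error a centred sum over users. Its
  -- second moment is therefore a variance, and variances add over users.
  have herr : ∀ T, reportError x a b T = (∑ j, fun T : Reports n p => X j (T j)) T -
      ∫ T, (∑ j, fun T : Reports n p => X j (T j)) T
        ∂(Measure.pi fun j => (μ j).prod (μ j)) := fun T => by
    rw [hint, reportError, Finset.sum_sub_distrib, mul_sub]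
    simp [hX, Finset.mul_sum]
  rw [hall]
  simp_rw [herr]
  refine ⟨(hsumL.sub (memLp_const _)).integrable_sq, ?_⟩
  rw [← variance_eq_integral hsumL.aestronglyMeasurable.aemeasurable,
    variance_sum_pi (μ := fun j => (μ j).prod (μ j)) hXL]
  have hs : ∀ j i, 0 ≤ s i := fun j i => (variance_nonneg _ _).trans (hvar j i)
  have hx : ∀ j i, (x j i : ℝ) ^ 2 ≤ 1 := fun j i =>
    (sq_le_one_iff_abs_le_one _).mpr (abs_le.mpr (x j i).2)
  calc ∑ j, Var[X j; (μ j).prod (μ j)]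
      ≤ ∑ _j : Fin n, (1 / (n : ℝ)) ^ 2 * (s a * s b + s a + s b) := by
        refine Finset.sum_le_sum fun j _ => ?_
        rw [hX, variance_const_mul]
        gcongr
        rw [variance_mul_prod (f := fun y : EuclideanSpace ℝ (Fin (p + 1)) => y a)
          (g := fun y : EuclideanSpace ℝ (Fin (p + 1)) => y b) (hL j a) (hL j b),
          hmean, hmean]
        -- The means are data entries of absolute value at most `1`, so the two mixed terms of the
        -- product variance are at most `s a` and `s b`.
        have ha := hvar j a
        have hb := hvar j b
        have ha0 := variance_nonneg (fun y : EuclideanSpace ℝ (Fin (p + 1)) => y a) (μ j)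
        have hb0 := variance_nonneg (fun y : EuclideanSpace ℝ (Fin (p + 1)) => y b) (μ j)
        gcongr
        · exact hs j a
        · exact (mul_le_of_le_one_right ha0 (hx j b)).trans ha
        · exact (mul_le_of_le_one_left hb0 (hx j a)).trans hb
    _ = _ := by
        rcases Nat.eq_zero_or_pos n with rfl | hn
        · simp
        have : (n : ℝ) ≠ 0 := by positivity
        simp
        field_simp

theorem measurable_reportErrorNorm (x : Fin n → DataCube p) : Measurable (reportErrorNorm x) := by
  unfold reportErrorNorm reportError
  fun_prop

/-- With `S = ∑ s_i`, summing `s_a s_b + s_a + s_b` over all pairs gives `S² + 2dS ≤ (S + √(2dS))²`,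
and the first moment is at most the root of the second. -/
theorem integral_reportErrorNorm_le (x : Fin n → DataCube p) (hs : ∀ i, 0 ≤ s i)
    (hL : ∀ j i, MemLp (fun y => y i) 2 (meanMechanism sphereChannel (fun i => c i / 2) (x j)))
    (hmean : ∀ j i, ∫ y, y i ∂(meanMechanism sphereChannel (fun i => c i / 2) (x j)) = x j i)
    (hvar : ∀ j i, Var[fun y => y i; meanMechanism sphereChannel (fun i => c i / 2) (x j)] ≤ s i) :
    Integrable (reportErrorNorm x) (allReports sphereChannel n c x) ∧
    ∫ T, reportErrorNorm x T ∂(allReports sphereChannel n c x) ≤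
      (∑ i, s i + √(2 * ((p : ℝ) + 1) * ∑ i, s i)) / √n := by
  have : IsMarkovKernel (allReports sphereChannel n c) := by unfold allReports; infer_instance
  set P := allReports sphereChannel n c x
  set S := ∑ i, s i
  have hS : 0 ≤ S := Finset.sum_nonneg fun i _ => hs i
  have hE := integral_reportError_sq_le x hL hmean hvar
  have hsq : ∀ T, reportErrorNorm x T ^ 2 =
      ∑ ab : Fin (p + 1) × Fin (p + 1), reportError x ab.1 ab.2 T ^ 2 := fun T =>
    Real.sq_sqrt (Finset.sum_nonneg fun _ _ => sq_nonneg _)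
  have hL2 : MemLp (reportErrorNorm x) 2 P := by
    rw [memLp_two_iff_integrable_sq (measurable_reportErrorNorm x).aestronglyMeasurable]
    simp_rw [hsq]
    exact integrable_finsetSum _ fun ab _ => (hE ab.1 ab.2).1
  have h2 : ∫ T, reportErrorNorm x T ^ 2 ∂P ≤
      (1 / (n : ℝ)) * (S ^ 2 + 2 * ((p : ℝ) + 1) * S) := by
    simp_rw [hsq]
    rw [integral_finsetSum _ fun ab _ => (hE ab.1 ab.2).1]
    refine (Finset.sum_le_sum fun ab _ => (hE ab.1 ab.2).2).trans (le_of_eq ?_)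
    rw [← Finset.mul_sum, Fintype.sum_prod_type]
    simp only [Finset.sum_add_distrib, ← Finset.mul_sum, ← Finset.sum_mul, Finset.sum_const,
      Finset.card_univ, Fintype.card_fin, nsmul_eq_mul]
    push_cast
    ring
  refine ⟨hL2.integrable one_le_two, ?_⟩
  -- Nonnegativity of the variance serves as Jensen's inequality for the square.
  have hvarF := variance_nonneg (reportErrorNorm x) P
  rw [variance_eq_sub hL2] at hvarF
  have h3 : (∫ T, reportErrorNorm x T ∂P) ^ 2 ≤
      ((S + √(2 * ((p : ℝ) + 1) * S)) / √n) ^ 2 := by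
    rw [div_pow, Real.sq_sqrt n.cast_nonneg, add_sq, Real.sq_sqrt (by positivity)]
    calc _ ≤ ∫ T, reportErrorNorm x T ^ 2 ∂P := by simpa using hvarF
      _ ≤ _ := h2
      _ ≤ _ := by
        rw [one_div_mul_eq_div]
        gcongr
        have : 0 ≤ 2 * S * √(2 * ((p : ℝ) + 1) * S) := by positivity
        linarith
  exact le_of_sq_le_sq h3 (by positivity)

end Stochastic

/-! ## The excess risk -/

section ExcessRisk

variable {n p : ℕ} {Θ : Set (EuclideanSpace ℝ (Fin p))}

instance (M : ChannelFamily) (c : Fin (p + 1) → ℝ) : IsMarkovKernel (allReports M n c) := by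
  unfold allReports; infer_instance

theorem exists_empRisk_eq_sInf (hΘ : IsCompact Θ) (hne : Θ.Nonempty) (x : Fin n → DataCube p) :
    ∃ θ ∈ Θ, sInf (empRisk x '' Θ) = empRisk x θ :=
  hΘ.exists_sInf_image_eq hne (continuous_empRisk x).continuousOn

theorem sInf_empRisk_le (hΘ : IsCompact Θ) (x : Fin n → DataCube p)
    {θ : EuclideanSpace ℝ (Fin p)} (hθ : θ ∈ Θ) : sInf (empRisk x '' Θ) ≤ empRisk x θ :=
  csInf_le (hΘ.bddBelow_image (continuous_empRisk x).continuousOn) ⟨θ, hθ, rfl⟩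

variable {opt : Kernel (Reports n p) (EuclideanSpace ℝ (Fin p))}

theorem ae_mem_lseMechanism (M : ChannelFamily) (c : Fin (p + 1) → ℝ) (hΘ : IsCompact Θ)
    (hopt : IsApproxMinimizer Θ opt) (x : Fin n → DataCube p) :
    ∀ᵐ θ ∂(lseMechanism M c opt x), θ ∈ Θ := by
  rw [lseMechanism, Kernel.comp_apply]
  change (Measure.bind _ _) Θᶜ = 0
  rw [Measure.bind_apply hΘ.isClosed.measurableSet.compl opt.measurable.aemeasurable]
  have : ∀ T, opt T Θᶜ = 0 := fun T => (hopt T).mono fun θ h => h.1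
  simp [this]

theorem excessRisk_le_dim (hn : 0 < n) (hΘ : IsCompact Θ) (x : Fin n → DataCube p)
    {θ : EuclideanSpace ℝ (Fin p)} (hθ : θ ∈ Θ) :
    empRisk x θ - sInf (empRisk x '' Θ) ≤ 2 * (maxNormTerm Θ * ((p : ℝ) + 1)) := by
  obtain ⟨θ', hθ', h⟩ := exists_empRisk_eq_sInf hΘ ⟨θ, hθ⟩ x
  rw [h]
  exact empRisk_sub_le_dim hn hΘ x hθ hθ'

variable [IsMarkovKernel opt]

instance (M : ChannelFamily) (c : Fin (p + 1) → ℝ) : IsMarkovKernel (lseMechanism M c opt) := by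
  unfold lseMechanism; infer_instance

theorem integrable_excessRisk (M : ChannelFamily) (c : Fin (p + 1) → ℝ) (hn : 0 < n)
    (hΘ : IsCompact Θ) (hopt : IsApproxMinimizer Θ opt) (x : Fin n → DataCube p) :
    Integrable (fun θ => empRisk x θ - sInf (empRisk x '' Θ)) (lseMechanism M c opt x) := by
  refine Integrable.of_bound
    ((continuous_empRisk x).sub continuous_const).aestronglyMeasurable
    (2 * (maxNormTerm Θ * ((p : ℝ) + 1))) ?_
  filter_upwards [ae_mem_lseMechanism M c hΘ hopt x] with θ hθ
  rw [Real.norm_of_nonneg (sub_nonneg.mpr (sInf_empRisk_le hΘ x hθ))]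
  exact excessRisk_le_dim hn hΘ x hθ

theorem integral_excessRisk_le_dim (M : ChannelFamily) (c : Fin (p + 1) → ℝ) (hn : 0 < n)
    (hΘ : IsCompact Θ) (hopt : IsApproxMinimizer Θ opt) (x : Fin n → DataCube p) :
    ∫ θ, (empRisk x θ - sInf (empRisk x '' Θ)) ∂(lseMechanism M c opt x) ≤
      2 * (maxNormTerm Θ * ((p : ℝ) + 1)) := by
  calc _ ≤ ∫ _, 2 * (maxNormTerm Θ * ((p : ℝ) + 1)) ∂(lseMechanism M c opt x) := by
        refine integral_mono_ae (integrable_excessRisk M c hn hΘ hopt x) (integrable_const _) ?_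
        filter_upwards [ae_mem_lseMechanism M c hΘ hopt x] with θ hθ
        exact excessRisk_le_dim hn hΘ x hθ
    _ = _ := by simp

/-- The deterministic comparison holds for each fixed vector of reports, almost surely over the
optimizer's randomness, and is then averaged over the reports. -/
theorem integral_excessRisk_le_reportErrorNorm (M : ChannelFamily) (c : Fin (p + 1) → ℝ)
    (hn : 0 < n) (hΘ : IsCompact Θ) (hne : Θ.Nonempty) (hopt : IsApproxMinimizer Θ opt)
    (x : Fin n → DataCube p) (hF : Integrable (reportErrorNorm x) (allReports M n c x)) :
    ∫ θ, (empRisk x θ - sInf (empRisk x '' Θ)) ∂(lseMechanism M c opt x) ≤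
      1 / (n : ℝ) + 2 * (maxNormTerm Θ * ∫ T, reportErrorNorm x T ∂(allReports M n c x)) := by
  have hρ := maxNormTerm_nonneg hΘ hne
  have hF0 : ∀ T, 0 ≤ reportErrorNorm x T := fun T => Real.sqrt_nonneg _
  have hb0 : ∀ T, 0 ≤ 1 / (n : ℝ) + 2 * (maxNormTerm Θ * reportErrorNorm x T) := fun T => by
    have := hF0 T
    positivity
  have hbI : Integrable (fun T => 1 / (n : ℝ) + 2 * (maxNormTerm Θ * reportErrorNorm x T))
      (allReports M n c x) := (integrable_const _).add ((hF.const_mul _).const_mul _)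
  have hgm : Measurable fun θ => ENNReal.ofReal (empRisk x θ - sInf (empRisk x '' Θ)) :=
    (((continuous_empRisk x).sub continuous_const).measurable).ennreal_ofReal
  have hbound : ENNReal.ofReal (∫ θ, (empRisk x θ - sInf (empRisk x '' Θ))
      ∂(lseMechanism M c opt x)) ≤ ENNReal.ofReal
        (∫ T, (1 / (n : ℝ) + 2 * (maxNormTerm Θ * reportErrorNorm x T)) ∂(allReports M n c x)) := by
    rw [ofReal_integral_eq_lintegral_ofReal (integrable_excessRisk M c hn hΘ hopt x),
      ofReal_integral_eq_lintegral_ofReal hbI (.of_forall hb0), lseMechanism,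
      Kernel.lintegral_comp _ _ _ hgm]
    · refine lintegral_mono fun T => ?_
      calc ∫⁻ θ, ENNReal.ofReal (empRisk x θ - sInf (empRisk x '' Θ)) ∂(opt T)
          ≤ ∫⁻ _, ENNReal.ofReal (1 / (n : ℝ) + 2 * (maxNormTerm Θ * reportErrorNorm x T))
            ∂(opt T) := by
            refine lintegral_mono_ae ?_
            filter_upwards [hopt T] with θ hθ
            refine ENNReal.ofReal_le_ofReal ?_
            obtain ⟨θ', hθ', h⟩ := exists_empRisk_eq_sInf hΘ hne x
            rw [h]
            linarith [empRisk_sub_le hΘ x T hθ.1 hθ', hθ.2 θ' hθ']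
        _ = _ := by simp
    · filter_upwards [ae_mem_lseMechanism M c hΘ hopt x] with θ hθ
      exact sub_nonneg.mpr (sInf_empRisk_le hΘ x hθ)
  rw [ENNReal.ofReal_le_ofReal_iff (integral_nonneg hb0)] at hbound
  refine hbound.trans (le_of_eq ?_)
  rw [integral_add (integrable_const _) ((hF.const_mul _).const_mul _), integral_const_mul,
    integral_const_mul]
  simp

theorem integral_excessRisk_of_dim_one (M : ChannelFamily) {n : ℕ} {c : Fin (0 + 1) → ℝ}
    {Θ : Set (EuclideanSpace ℝ (Fin 0))}
    {opt : Kernel (Reports n 0) (EuclideanSpace ℝ (Fin 0))} (hΘ : IsCompact Θ)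
    (hne : Θ.Nonempty) (x : Fin n → DataCube 0) :
    ∫ θ, (empRisk x θ - sInf (empRisk x '' Θ)) ∂(lseMechanism M c opt x) = 0 := by
  obtain ⟨θ', -, h⟩ := exists_empRisk_eq_sInf hΘ hne x
  rw [h]
  simp [Subsingleton.elim _ θ']

end ExcessRisk

/-! ## The rate -/

section Rate

variable {p : ℕ} {c : Fin (p + 1) → ℝ}

theorem weight_half (c : Fin (p + 1) → ℝ) (k : Fin (p + 1)) :
    weight (fun i => c i / 2) k = weight c k / 4 := by
  rw [weight, weight, increment_half]
  ring

theorem sum_weight_pos (h : 0 < weight c 0) (i : Fin (p + 1)) :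
    0 < ∑ k ∈ Finset.Iic i, weight c k :=
  Finset.sum_pos' (fun k _ => weight_nonneg c k) ⟨0, by simp, h⟩

theorem rSq_eq_ofReal (h : 0 < weight c 0) :
    rSq c = ENNReal.ofReal (∑ i, (∑ k ∈ Finset.Iic i, weight c k)⁻¹) := by
  rw [rSq, ENNReal.ofReal_sum_of_nonneg fun i _ => (inv_pos.mpr (sum_weight_pos h i)).le]
  refine Finset.sum_congr rfl fun i _ => ?_
  rw [← ENNReal.ofReal_sum_of_nonneg fun k _ => weight_nonneg c k,
    ENNReal.ofReal_inv_of_pos (sum_weight_pos h i)]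

/-- The weight `w_1` decides whether `r²` is finite: it occurs in every denominator and is the whole
of the first one. -/
theorem rSq_eq_top (h : weight c 0 = 0) : rSq c = ∞ := by
  refine ENNReal.sum_eq_top.mpr ⟨0, Finset.mem_univ _, ?_⟩
  have : Finset.Iic (0 : Fin (p + 1)) = {0} := by
    ext k; simp
  simp [this, h]

theorem lseRate_eq_min (n : ℕ) (h : 0 < weight c 0) :
    lseRate n c = min (Real.log ((p : ℝ) + 1) / √n *
      (∑ i, (∑ k ∈ Finset.Iic i, weight c k)⁻¹ +
        √(∑ i, (∑ k ∈ Finset.Iic i, weight c k)⁻¹) * ((p : ℝ) + 1))) ((p : ℝ) + 1) := by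
  set R := ∑ i, (∑ k ∈ Finset.Iic i, weight c k)⁻¹
  have hR : 0 ≤ R := Finset.sum_nonneg fun i _ => (inv_pos.mpr (sum_weight_pos h i)).le
  have hlog : 0 ≤ Real.log ((p : ℝ) + 1) := Real.log_nonneg (by linarith [p.cast_nonneg (α := ℝ)])
  have hd : ((p + 1 : ℕ) : ℝ≥0∞) = ENNReal.ofReal ((p : ℝ) + 1) := by
    rw [← Nat.cast_add_one, ENNReal.ofReal_natCast]
  rw [lseRate, rSq_eq_ofReal h, ENNReal.ofReal_rpow_of_nonneg hR (by norm_num),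
    ← Real.sqrt_eq_rpow, hd, ← ENNReal.ofReal_mul (Real.sqrt_nonneg _),
    ← ENNReal.ofReal_add hR (by positivity), ← ENNReal.ofReal_mul (by positivity),
    ← ENNReal.ofReal_min, ENNReal.toReal_ofReal]
  positivity

/-- For `d ≥ 2` the logarithm is positive, so the infinite `r²` leaves only the cap. For `d = 1` the
product `0 · ∞` would be `0` instead. -/
theorem lseRate_of_weight_eq_zero {n : ℕ} (hn : 0 < n) (hp : 0 < p) (h : weight c 0 = 0) :
    lseRate n c = (p : ℝ) + 1 := by
  have hlog : 0 < Real.log ((p : ℝ) + 1) / √n := by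
    have : (0 : ℝ) < p := by exact_mod_cast hp
    have : (0 : ℝ) < n := by exact_mod_cast hn
    exact div_pos (Real.log_pos (by linarith)) (by positivity)
  rw [lseRate, rSq_eq_top h, top_add, ENNReal.mul_top (by simpa using hlog), min_eq_right le_top,
    ENNReal.toReal_natCast]
  simp

theorem lseRate_nonneg (n : ℕ) (c : Fin (p + 1) → ℝ) : 0 ≤ lseRate n c := ENNReal.toReal_nonneg

theorem increment_le_last (hc0 : 0 ≤ c 0) (hc : Monotone c) (k : Fin (p + 1)) :
    increment c k ≤ c (Fin.last p) := by
  have hk := hc (Fin.le_last k)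
  have : 0 ≤ (Fin.cons 0 c : Fin (p + 2) → ℝ) k.castSucc := by
    refine Fin.cases ?_ (fun j => ?_) k
    · simp
    · simpa using hc0.trans (hc (Fin.zero_le _))
  rw [increment]
  linarith

/-- Bounded levels keep `r²` away from zero, since `r² ≥ 1/w_1` and `w_1 ≤ L²`. This allows the
optimization error `1/n` to be absorbed later. -/
theorem one_le_sq_mul_sum_inv {L : ℝ} (hc0 : 0 ≤ c 0) (hL : c 0 ≤ L) (h : 0 < weight c 0) :
    1 ≤ L ^ 2 * ∑ i, (∑ k ∈ Finset.Iic i, weight c k)⁻¹ := by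
  have h0 : Finset.Iic (0 : Fin (p + 1)) = {0} := by
    ext k; simp
  have h1 : (weight c 0)⁻¹ ≤ ∑ i, (∑ k ∈ Finset.Iic i, weight c k)⁻¹ := by
    have := Finset.single_le_sum (f := fun i => (∑ k ∈ Finset.Iic i, weight c k)⁻¹)
      (fun i _ => (inv_pos.mpr (sum_weight_pos h i)).le) (Finset.mem_univ 0)
    simpa [h0] using this
  have h2 : weight c 0 ≤ L ^ 2 := by
    have hinc : increment c 0 = c 0 := by simp [increment]
    rw [weight, hinc]
    refine (div_le_self (sq_nonneg _) ?_).trans (pow_le_pow_left₀ hc0 hL 2)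
    exact_mod_cast Nat.succ_le_succ (Nat.zero_le _)
  calc (1 : ℝ) = weight c 0 * (weight c 0)⁻¹ := (mul_inv_cancel₀ h.ne').symm
    _ ≤ _ := mul_le_mul h2 h1 (inv_pos.mpr h).le (sq_nonneg _)

/-- The Frobenius error of the reports, in terms of the weights. -/
theorem integral_reportErrorNorm_le_weights {n : ℕ} {Λ : ℝ} (hc0 : 0 ≤ c 0) (hc : Monotone c)
    (hΛ0 : 0 ≤ Λ) (hΛ : c (Fin.last p) ≤ Λ) (h : 0 < weight c 0) (x : Fin n → DataCube p) :
    Integrable (reportErrorNorm x) (allReports sphereChannel n c x) ∧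
    ∫ T, reportErrorNorm x T ∂(allReports sphereChannel n c x) ≤
      8 * (Real.pi * (Real.exp Λ + 1) ^ 2) / √n *
        (∑ i, (∑ k ∈ Finset.Iic i, weight c k)⁻¹ +
          √(∑ i, (∑ k ∈ Finset.Iic i, weight c k)⁻¹) * ((p : ℝ) + 1)) := by
  set K := Real.pi * (Real.exp Λ + 1) ^ 2
  set R := ∑ i, (∑ k ∈ Finset.Iic i, weight c k)⁻¹ with hR
  have hR0 : 0 ≤ R := Finset.sum_nonneg fun i _ => (inv_pos.mpr (sum_weight_pos h i)).le
  have hK1 : 1 ≤ K := by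
    have h1 : 1 ≤ Real.exp Λ + 1 := by linarith [Real.exp_pos Λ]
    exact one_le_mul_of_one_le_of_one_le (by linarith [Real.pi_gt_three]) (one_le_pow₀ h1)
  have hinc : ∀ k, 0 ≤ increment (fun i => c i / 2) k := fun k => by
    rw [increment_half]
    linarith [increment_nonneg hc0 hc k]
  have hincΛ : ∀ k, increment (fun i => c i / 2) k ≤ Λ := fun k => by
    rw [increment_half]
    linarith [increment_le_last hc0 hc k]
  have hWsum : ∀ i, ∑ k ∈ Finset.Iic i, weight (fun i => c i / 2) k =
      (∑ k ∈ Finset.Iic i, weight c k) / 4 := fun i => by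
    simp_rw [weight_half, Finset.sum_div]
  have hW : ∀ i, 0 < ∑ k ∈ Finset.Iic i, weight (fun i => c i / 2) k := fun i => by
    rw [hWsum]
    linarith [sum_weight_pos h i]
  have hmain := integral_reportErrorNorm_le (c := c)
    (s := fun i => K * (∑ k ∈ Finset.Iic i, weight (fun i => c i / 2) k)⁻¹) x
    (fun i => mul_nonneg (by linarith) (inv_pos.mpr (hW i)).le)
    (fun j i => memLp_coord_meanMechanism hinc i (x j))
    (fun j i => integral_coord_meanMechanism hinc (hW i) (x j))
    (fun j i => variance_coord_meanMechanism_le hinc hincΛ (hW i) (x j))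
  refine ⟨hmain.1, hmain.2.trans ?_⟩
  -- The factor `4` is the price of halving the levels, because the weights are quadratic in them.
  have hS : ∑ i, K * (∑ k ∈ Finset.Iic i, weight (fun i => c i / 2) k)⁻¹ = 4 * K * R := by
    simp_rw [hWsum, inv_div, hR, Finset.mul_sum]
    refine Finset.sum_congr rfl fun i _ => ?_
    ring
  -- Here `√d` is weakened to `d` and `√(8K)` to `8K`, which is legitimate as both `d` and `8K` are
  -- at least `1`.
  have hsqrt : √(2 * ((p : ℝ) + 1) * (4 * K * R)) ≤ 8 * K * (√R * ((p : ℝ) + 1)) := by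
    refine Real.sqrt_le_iff.mpr ⟨by positivity, ?_⟩
    have h8 : 8 * K ≤ (8 * K) ^ 2 := by nlinarith
    have hp : (p : ℝ) + 1 ≤ ((p : ℝ) + 1) ^ 2 := by nlinarith [p.cast_nonneg (α := ℝ)]
    calc 2 * ((p : ℝ) + 1) * (4 * K * R) = 8 * K * (((p : ℝ) + 1) * R) := by ring
      _ ≤ (8 * K) ^ 2 * (((p : ℝ) + 1) ^ 2 * R) := by gcongr
      _ = _ := by
        rw [mul_pow (8 * K), mul_pow (√R), Real.sq_sqrt hR0]
        ring
  rw [hS, div_mul_eq_mul_div]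
  gcongr
  nlinarith

end Rate

/-! ### The expected excess risk with the sphere channel. -/

theorem exists_excessRisk_rate (Λ : ℝ) : ∃ C : ℝ, 0 < C ∧
    ∀ (n p : ℕ) (c : Fin (p + 1) → ℝ), 0 < n → 0 ≤ c 0 → Monotone c → c (Fin.last p) ≤ Λ →
    ∀ (Θ : Set (EuclideanSpace ℝ (Fin p))), Θ.Nonempty → IsCompact Θ →
    ∀ (opt : Kernel (Reports n p) (EuclideanSpace ℝ (Fin p))), IsMarkovKernel opt →
      IsApproxMinimizer Θ opt →
    ∀ x : Fin n → DataCube p,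
      ∫ θ, (empRisk x θ - sInf (empRisk x '' Θ)) ∂(lseMechanism sphereChannel c opt x)
        ≤ C * maxNormTerm Θ * lseRate n c + 1 / (n : ℝ) ∧
      (1 / √n ≤ maxNormTerm Θ →
        ∫ θ, (empRisk x θ - sInf (empRisk x '' Θ)) ∂(lseMechanism sphereChannel c opt x)
        ≤ C * maxNormTerm Θ * lseRate n c) := by
  set L := max Λ 0
  set K := Real.pi * (Real.exp L + 1) ^ 2
  have hK0 : 0 < K := by
    have := Real.pi_pos
    positivity
  have hlog2 : 0 < Real.log 2 := Real.log_pos one_lt_two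
  -- The `2` covers the trivial bound by the dimension, `16K` the Frobenius error, and `L²` the
  -- absorption of `1/n`. Division by `log 2` pays for the factor `log d` when `d ≥ 2`.
  refine ⟨2 + (16 * K + L ^ 2) / Real.log 2, by positivity, ?_⟩
  set C := 2 + (16 * K + L ^ 2) / Real.log 2
  have hC2 : 2 ≤ C := le_add_of_nonneg_right (by positivity)
  intro n p c hn hc0 hc hcΛ Θ hne hΘ opt _ hopt x
  have hρ := maxNormTerm_nonneg hΘ hne
  set ρ := maxNormTerm Θ
  have hn' : (0 : ℝ) < n := by exact_mod_cast hn
  have hrate := lseRate_nonneg n c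
  -- For `d = 1` the parameter space is a single point, so the excess risk vanishes and matches the
  -- rate, whose factor `log 1` is zero.
  rcases Nat.eq_zero_or_pos p with rfl | hp
  · rw [integral_excessRisk_of_dim_one _ hΘ hne]
    exact ⟨by positivity, fun _ => by positivity⟩
  set I := ∫ θ, (empRisk x θ - sInf (empRisk x '' Θ)) ∂(lseMechanism sphereChannel c opt x)
  have hdim : I ≤ 2 * (ρ * ((p : ℝ) + 1)) := integral_excessRisk_le_dim _ c hn hΘ hopt x
  have hdimC : I ≤ C * ρ * ((p : ℝ) + 1) := by
    refine hdim.trans ?_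
    rw [← mul_assoc]
    gcongr
  have hn1 : 0 ≤ 1 / (n : ℝ) := by positivity
  -- If `w_1 = 0` the estimates may be biased and `r²` is infinite; the bound by the dimension is
  -- then the whole claim.
  rcases (weight_nonneg c 0).eq_or_lt with h0 | h0
  · rw [lseRate_of_weight_eq_zero hn hp h0.symm]
    exact ⟨hdimC.trans (le_add_of_nonneg_right hn1), fun _ => hdimC⟩
  rw [lseRate_eq_min n h0]
  obtain ⟨hFi, hF⟩ := integral_reportErrorNorm_le_weights hc0 hc (le_max_right Λ 0)
    (hcΛ.trans (le_max_left Λ 0)) h0 x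
  have hone := one_le_sq_mul_sum_inv hc0
    ((hc (Fin.zero_le _)).trans (hcΛ.trans (le_max_left Λ 0))) h0
  set R := ∑ i, (∑ k ∈ Finset.Iic i, weight c k)⁻¹
  set A := R + √R * ((p : ℝ) + 1)
  have hRA : R ≤ A := le_add_of_nonneg_right (by positivity)
  have hR0 : 0 ≤ R := Finset.sum_nonneg fun i _ => (inv_pos.mpr (sum_weight_pos h0 i)).le
  have hA0 : 0 ≤ A := hR0.trans hRA
  rcases le_total (Real.log ((p : ℝ) + 1) / √n * A) ((p : ℝ) + 1) with hle | hle
  swap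
  · rw [min_eq_right hle]
    exact ⟨hdimC.trans (le_add_of_nonneg_right hn1), fun _ => hdimC⟩
  rw [min_eq_left hle]
  have hI : I ≤ 1 / (n : ℝ) + 16 * K * (ρ * (A / √n)) := by
    refine (integral_excessRisk_le_reportErrorNorm _ c hn hΘ hne hopt x hFi).trans ?_
    have := mul_le_mul_of_nonneg_left hF hρ
    have h2 : 16 * K * (ρ * (A / √n)) = 2 * (ρ * (8 * K / √n * A)) := by ring
    rw [h2]
    linarith
  have hlog : A / √n ≤ Real.log ((p : ℝ) + 1) / √n * A / Real.log 2 := by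
    have hlogp : Real.log 2 ≤ Real.log ((p : ℝ) + 1) := by
      refine Real.log_le_log two_pos ?_
      have : (1 : ℝ) ≤ p := by exact_mod_cast hp
      linarith
    rw [le_div_iff₀ hlog2]
    calc A / √n * Real.log 2 ≤ A / √n * Real.log ((p : ℝ) + 1) := by gcongr
      _ = _ := by ring
  set a := Real.log ((p : ℝ) + 1) / √n * A
  have ha0 : 0 ≤ a := by
    have : 0 ≤ A / √n := by positivity
    have := (le_div_iff₀ hlog2).mp (this.trans hlog)
    linarith
  have hCa : 16 * K * (ρ * (A / √n)) + L ^ 2 * (ρ * (A / √n)) ≤ C * ρ * a := by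
    calc 16 * K * (ρ * (A / √n)) + L ^ 2 * (ρ * (A / √n))
        ≤ 16 * K * (ρ * (a / Real.log 2)) + L ^ 2 * (ρ * (a / Real.log 2)) := by gcongr
      _ = (16 * K + L ^ 2) / Real.log 2 * ρ * a := by ring
      _ ≤ C * ρ * a := by
        gcongr
        exact le_add_of_nonneg_left zero_le_two
  have hLA : 0 ≤ L ^ 2 * (ρ * (A / √n)) := by positivity
  refine ⟨by linarith, fun hρn => ?_⟩
  -- One factor of `1/n = (1/√n)(1/√n)` is bounded by `ρ`, and the number `1` by `L² R ≤ L² A`.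
  have hnρ : 1 / (n : ℝ) ≤ L ^ 2 * (ρ * (A / √n)) := by
    calc 1 / (n : ℝ) = 1 / √n * (1 / √n) := by
          rw [div_mul_div_comm, Real.mul_self_sqrt hn'.le, one_mul]
      _ ≤ ρ * (L ^ 2 * A / √n) := by
          gcongr
          exact hone.trans (by gcongr)
      _ = _ := by ring
  linarith

/-! ### Privacy and error rate combined. -/

theorem mainTheorem2 :
    -- privacy, for every locally private black box, every optimizer and all priors
    (∀ (M : ChannelFamily), M.IsLDP →
      ∀ (n p : ℕ) (δ : Fin (p + 1) → ℝ) (ε ζ q : ℝ),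
        (∀ i, 0 ≤ δ i) → Monotone δ → 0 ≤ ε → 0 < ζ → ζ ≤ 1 → 0 ≤ q →
      ∀ (π : Fin n → Measure (DataCube p)), (∀ j, IsProbabilityMeasure (π j)) →
        (∀ (i : Fin (p + 1)), i ≠ Fin.last p → ∀ (j : Fin n) (S S' : Set (Icc (-1 : ℝ) 1)),
          MeasurableSet S → MeasurableSet S' →
          0 < π j (coordEvent i S) → 0 < π j (coordEvent i S') →
          tvDist (condOthers (π j) i S) (condOthers (π j) i S') ≤ q) →
      ∀ (opt : Kernel (Reports n p) (EuclideanSpace ℝ (Fin p))), IsMarkovKernel opt →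
      ∀ j : Fin n,
        IsBCDP (π j) (userReport M (levels δ ε ζ q)) δ ∧
        IsLDP (userReport M (levels δ ε ζ q)) ε ∧
        ∀ x : Fin n → DataCube p,
          IsBCDP (π j) (lseMechanismAt M (levels δ ε ζ q) opt x j) δ ∧
          IsLDP (lseMechanismAt M (levels δ ε ζ q) opt x j) ε) ∧
    -- the sphere channel is such a black box
    sphereChannel.IsLDP ∧
    -- error rate with the sphere channel
    (∀ Λ : ℝ, ∃ C : ℝ, 0 < C ∧
      ∀ (n p : ℕ) (δ : Fin (p + 1) → ℝ) (ε ζ q : ℝ), 0 < n →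
        (∀ i, 0 ≤ δ i) → Monotone δ → 0 ≤ ε → 0 < ζ → ζ ≤ 1 → 0 ≤ q →
        levels δ ε ζ q (Fin.last p) ≤ Λ →
      ∀ (Θ : Set (EuclideanSpace ℝ (Fin p))), Θ.Nonempty → IsCompact Θ → Convex ℝ Θ →
      ∀ (opt : Kernel (Reports n p) (EuclideanSpace ℝ (Fin p))), IsMarkovKernel opt →
        IsApproxMinimizer Θ opt →
      ∀ x : Fin n → DataCube p,
        Integrable (fun θ => empRisk x θ - sInf (empRisk x '' Θ))
          (lseMechanism sphereChannel (levels δ ε ζ q) opt x) ∧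
        ∫ θ, (empRisk x θ - sInf (empRisk x '' Θ))
            ∂(lseMechanism sphereChannel (levels δ ε ζ q) opt x)
          ≤ C * maxNormTerm Θ * lseRate n (levels δ ε ζ q) + 1 / (n : ℝ) ∧
        (1 / Real.sqrt n ≤ maxNormTerm Θ →
          ∫ θ, (empRisk x θ - sInf (empRisk x '' Θ))
            ∂(lseMechanism sphereChannel (levels δ ε ζ q) opt x)
          ≤ C * maxNormTerm Θ * lseRate n (levels δ ε ζ q))) := by
  refine ⟨?_, isLDP_sphereChannel, fun Λ => ?_⟩
  · intro M hM n p δ ε ζ q hδ hmono hε hζ hζ1 hq π _ hπ opt _ j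
    exact userReport_and_lseMechanismAt_private M hM n p δ ε ζ q hδ hmono hε hζ hζ1 hq (π j) (fun i hi => hπ i hi j) opt j
  · obtain ⟨C, hC, h⟩ := exists_excessRisk_rate Λ
    refine ⟨C, hC, ?_⟩
    intro n p δ ε ζ q hn hδ hmono hε hζ hζ1 hq hΛ Θ hne hΘ _ opt _ hopt x
    exact ⟨integrable_excessRisk _ _ hn hΘ hopt x,
      h n p _ hn (levels_nonneg hδ hmono hε hζ hζ1 hq 0) (monotone_levels hδ hmono hε hζ hq) hΛ
        Θ hne hΘ opt inferInstance hopt x⟩
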